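/- Let $\mathbb T=[0,\infty)$ and let $\mathcal X=C([2,\infty),\mathbb R)$ with the pseudonorms $\|g\|_n=\sup_{2\le x\le n}|g(x)|$ ($n\ge 2$), the metric $d(f,g)=\sum_{n\ge 2}2^{-n}\min(\|f-g\|_n,1)$ and the topology of locally uniform convergence. For $E=\mathbb R$ or $E=\mathcal X$ let $C^1(\mathbb T,E)$ be the space of continuously differentiable streams $u:\mathbb T\to E$, with the topology of locally uniform convergence of $u$ and $u'$. For a nondecreasing $T\in C^1(\mathbb T,\mathbb R)$, a stream $u\in C^1(\mathbb T,\mathcal X)$ is a *$T$-convergent Cauchy stream* if $d(u(s),u(t))<2^{-\tau}$ for all $\tau\in\mathbb T$ and all $s,t\ge T(\tau)$; $T$ is then called a modulus, and it is *effective* if it is generated by a network (as below) all of whose channels are real. An *L-GPAC* is a finite network whose channels carry scalars or $C^1$ streams with data in $\mathbb R$ or in $\mathcal X$ (real channels may feed $\mathcal X$-inputs as constant functions), built from constant modules, adders $u+v$, multipliers $uv$, integrators $w(t)=c+\int_0^t u(s)v'(s)\,ds$, and limit modules; a limit module accepts a stream $u\in C^1(\mathbb T,\mathcal X)$ that is an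 $\mathrm{id}$-convergent Cauchy stream and outputs $\lim_{t\to\infty}u(t)\in\mathcal X$. Each module input is connected to at most one module output; a line carrying the independent variable $t$ is available, and the remaining unconnected inputs are the proper inputs. The network is *well-posed* on an open set $U$ of proper inputs if for each of them the equations of all modules have exactly one simultaneous solution, depending continuously on the input; it then *generates* this solution. Below, networks have no proper inputs other than $t$. For $t\ge 0$ and $x\ge 2$ put $$\zeta_2(t,x)=\frac{\sin(x\arctan t)}{(1+t^2)^{x/2}(e^{\pi t}+1)},\qquad \zeta_1(t,x)=\frac{2^{x-1}}{x-1}-2^x\int_0^t\zeta_2(s,x)\,ds .$$ **Theorem.** The Riemann zeta function on $[2,\infty)$ is L-GPAC-generable. More precisely: 1. $\zeta_1,\zeta_2\in C^1(\mathbb T,\mathcal X)$, and for every $x\ge2$ the function $t\mapsto\zeta_2(t,x)$ is integrable on $(0,\infty)$ with $\zeta(x)=\frac{2^{x-1}}{x-1}-2^x\int_0^\infty\zeta_2(t,x)\,dt$; moreover $\zeta_1(t)\to\zeta$ in $\mathcal X$ as $t\to\infty$. 2. This limit is effective with a linear modulus: for every real $C\ge1$, $T(\tau)=C\tau$ is an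 effective modulus and $\zeta_1$ is a $T$-convergent Cauchy stream. In particular $\zeta_1$ is $\mathrm{id}$-convergent. 3. $\zeta_2$ is generated by a well-posed network without limit modules whose only constants are real numbers and the function $x\mapsto x$. 4. There is a well-posed L-GPAC whose only constants are real numbers and the functions $x\mapsto x$, $x\mapsto-2^x$, $x\mapsto\frac{2^{x-1}}{x-1}$, in which one channel carries $\zeta_2$, an integrator with initial setting $\frac{2^{x-1}}{x-1}$, integrand $-2^x\zeta_2$ and integration variable $t$ outputs $\zeta_1$, and a limit module that receives $\zeta_1$ outputs $\zeta$ on a proper output channel (one that is connected to no module input). -/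

import Mathlib

open Set Filter Topology MeasureTheory
open scoped NNReal

noncomputable section

namespace LGPAC

/-! ### Continuously differentiable streams -/

section Stream

variable (E : Type) [AddCommGroup E] [Module ℝ E] [TopologicalSpace E]

/-- `d` is the time derivative of `u : [0,∞) → E` at every time: the difference quotients
converge in `E` (one-sided at `t = 0`). -/
def HasTimeDeriv {E : Type} [AddCommGroup E] [Module ℝ E] [TopologicalSpace E]
    (u d : ℝ≥0 → E) : Prop :=
  ∀ t : ℝ≥0, Tendsto (fun s : ℝ≥0 => ((s : ℝ) - (t : ℝ))⁻¹ • (u s - u t)) (𝓝[≠] t) (𝓝 (d t))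

/-- The space `C¹(𝕋, E)` of continuously differentiable streams, with `𝕋 = [0,∞)`. -/
structure C1Stream where
  toMap : C(ℝ≥0, E)
  exists_deriv : ∃ d : C(ℝ≥0, E), HasTimeDeriv toMap d

variable {E}

instance : CoeFun (C1Stream E) (fun _ => ℝ≥0 → E) := ⟨fun u => u.toMap⟩

/-- The time derivative `u'` of a stream (unique when `E` is Hausdorff). -/
def C1Stream.deriv (u : C1Stream E) : C(ℝ≥0, E) := u.exists_deriv.choose

/-- The `C¹` topology: locally uniform convergence of the stream and of its derivative. -/
instance : TopologicalSpace (C1Stream E) :=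
  TopologicalSpace.induced (fun u : C1Stream E => (u.toMap, u.deriv)) inferInstance

/-- The constant stream. -/
def C1Stream.const (c : E) : C1Stream E where
  toMap := ContinuousMap.const _ c
  exists_deriv := ⟨ContinuousMap.const _ 0, fun t => by simpa using tendsto_const_nhds⟩

/-- The real stream `t ↦ C t`. -/
def C1Stream.linear (C : ℝ) : C1Stream ℝ where
  toMap := ⟨fun t => C * (t : ℝ), by fun_prop⟩
  exists_deriv := ⟨ContinuousMap.const _ C, fun t => by
    refine tendsto_const_nhds.congr' ?_
    filter_upwards [self_mem_nhdsWithin] with s hs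
    have h : (s : ℝ) - t ≠ 0 := sub_ne_zero.mpr (fun h => hs (NNReal.coe_injective h))
    simp only [ContinuousMap.coe_mk, ContinuousMap.const_apply, smul_eq_mul]
    field_simp⟩

/-- Time itself, the stream `t ↦ t`. -/
def C1Stream.time : C1Stream ℝ := C1Stream.linear 1

/-- A real stream seen as a stream of constant functions on `Ω`. -/
def C1Stream.lift (Ω : Set ℝ) (u : C1Stream ℝ) : C1Stream C(Ω, ℝ) where
  toMap := ⟨fun t => ContinuousMap.const Ω (u t), by fun_prop⟩
  exists_deriv := by
    obtain ⟨d, hd⟩ := u.exists_deriv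
    refine ⟨⟨fun t => ContinuousMap.const Ω (d t), by fun_prop⟩, fun t => ?_⟩
    have hc : Continuous (fun r : ℝ => ContinuousMap.const Ω r) := by fun_prop
    exact (hc.tendsto _).comp (hd t)

end Stream

/-! ### The Fréchet space `C(Ω, ℝ)` and effective limits -/

section Limits

variable {Ω : Set ℝ}

/-- The pseudonorm `‖g‖ₙ = sup {|g x| : x ∈ Ω, |x| ≤ n}` (it is `0` if there is no such `x`).
For `Ω = [2,∞)` this is the supremum over `2 ≤ x ≤ n`. -/
def pseudoNorm (n : ℕ) (g : C(Ω, ℝ)) : ℝ :=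
  ⨆ x : {x : Ω // |(x : ℝ)| ≤ (n : ℝ)}, |g x.1|

/-- The metric `d(f, g) = ∑_{n ≥ 1} 2⁻ⁿ min(‖f - g‖ₙ, 1)`. -/
def frechetDist (f g : C(Ω, ℝ)) : ℝ :=
  ∑' n : ℕ, (2 : ℝ)⁻¹ ^ (n + 1) * min (pseudoNorm (n + 1) (f - g)) 1

/-- `u` is a `T`-convergent Cauchy stream: for all `τ` and all `s, t ≥ T(τ)` one has
`d(u(s), u(t)) < 2^(-τ)`. -/
def IsConvergentCauchy (T : C1Stream ℝ) (u : C1Stream C(Ω, ℝ)) : Prop :=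
  ∀ τ s t : ℝ≥0, T τ ≤ (s : ℝ) → T τ ≤ (t : ℝ) →
    frechetDist (u s) (u t) < (2 : ℝ) ^ (-(τ : ℝ))

end Limits

/-! ### Networks -/

/-- The four channel types: scalars and streams, with data in `ℝ` or in `C(Ω, ℝ)`. -/
inductive Channel where
  | realScalar
  | fnScalar
  | realStream
  | fnStream

/-- The values that a channel of a given type can carry. -/
def Val (Ω : Set ℝ) : Channel → Type
  | .realScalar => ℝ
  | .fnScalar => C(Ω, ℝ)
  | .realStream => C1Stream ℝ
  | .fnStream => C1Stream C(Ω, ℝ)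

instance (Ω : Set ℝ) : (σ : Channel) → TopologicalSpace (Val Ω σ)
  | .realScalar => inferInstanceAs (TopologicalSpace ℝ)
  | .fnScalar => inferInstanceAs (TopologicalSpace C(Ω, ℝ))
  | .realStream => inferInstanceAs (TopologicalSpace (C1Stream ℝ))
  | .fnStream => inferInstanceAs (TopologicalSpace (C1Stream C(Ω, ℝ)))

/-- What an input of a module may be connected to, in a network with `n` modules whose outputs
have types `ty` and with `k` proper inputs of types `inTy`: the output of a module, a proper input
channel, or the line carrying the independent variable `t`. A real channel may feed an input of
function type, through the embedding of `ℝ` in `C(Ω, ℝ)` as constant functions. -/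
inductive Source {n k : ℕ} (ty : Fin n → Channel) (inTy : Fin k → Channel) : Channel → Type
  | node (j : Fin n) : Source ty inTy (ty j)
  | input (i : Fin k) : Source ty inTy (inTy i)
  | time : Source ty inTy .realStream
  | liftScalar (s : Source ty inTy .realScalar) : Source ty inTy .fnScalar
  | liftStream (s : Source ty inTy .realStream) : Source ty inTy .fnStream

/-- A module together with the connections of its inputs; the index is the type of its output. -/
inductive Node (Ω : Set ℝ) {n k : ℕ} (ty : Fin n → Channel) (inTy : Fin k → Channel) :
    Channel → Type
  | constRealScalar (c : ℝ) : Node Ω ty inTy .realScalar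
  | constFnScalar (g : C(Ω, ℝ)) : Node Ω ty inTy .fnScalar
  | constReal (c : ℝ) : Node Ω ty inTy .realStream
  | constFn (g : C(Ω, ℝ)) : Node Ω ty inTy .fnStream
  | addReal (u v : Source ty inTy .realStream) : Node Ω ty inTy .realStream
  | addFn (u v : Source ty inTy .fnStream) : Node Ω ty inTy .fnStream
  | mulReal (u v : Source ty inTy .realStream) : Node Ω ty inTy .realStream
  | mulFn (u v : Source ty inTy .fnStream) : Node Ω ty inTy .fnStream
  | integralReal (c : Source ty inTy .realScalar) (u v : Source ty inTy .realStream) :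
      Node Ω ty inTy .realStream
  | integralFn (c : Source ty inTy .fnScalar) (u v : Source ty inTy .fnStream) :
      Node Ω ty inTy .fnStream
  | limit (u : Source ty inTy .fnStream) : Node Ω ty inTy .fnScalar

/-- A limit general purpose analog computer over `C(Ω, ℝ)`: a finite network of modules. -/
structure Network (Ω : Set ℝ) where
  numModules : ℕ
  numInputs : ℕ
  ty : Fin numModules → Channel
  inTy : Fin numInputs → Channel
  node : ∀ j, Node Ω ty inTy (ty j)

section Semantics

variable {Ω : Set ℝ} {n k : ℕ} {ty : Fin n → Channel} {inTy : Fin k → Channel}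

/-- The value delivered by a source. -/
def Source.eval (inp : ∀ i, Val Ω (inTy i)) (st : ∀ j, Val Ω (ty j)) :
    {σ : Channel} → Source ty inTy σ → Val Ω σ
  | _, .node j => st j
  | _, .input i => inp i
  | _, .time => C1Stream.time
  | _, .liftScalar s => ContinuousMap.const Ω (show ℝ from s.eval inp st)
  | _, .liftStream s => C1Stream.lift Ω (s.eval inp st)

/-- The modules whose output a source reads. -/
def Source.reads : {σ : Channel} → Source ty inTy σ → Set (Fin n)
  | _, .node j => {j}
  | _, .input _ => ∅
  | _, .time => ∅
  | _, .liftScalar s => s.reads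
  | _, .liftStream s => s.reads

/-- `w(t) = c + ∫₀ᵗ u(s) v'(s) ds` for real streams. -/
def IsIntegralReal (c : ℝ) (u v w : C1Stream ℝ) : Prop :=
  ∀ t : ℝ≥0, w t = c + ∫ s in (0 : ℝ)..t, u s.toNNReal * v.deriv s.toNNReal

/-- `w(t, x) = c(x) + ∫₀ᵗ u(s, x) v'(s, x) ds` for streams in `C(Ω, ℝ)`. -/
def IsIntegralFn (c : C(Ω, ℝ)) (u v w : C1Stream C(Ω, ℝ)) : Prop :=
  ∀ (t : ℝ≥0) (x : Ω), w t x = c x + ∫ s in (0 : ℝ)..t, u s.toNNReal x * v.deriv s.toNNReal x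

/-- `g` is the `id`-convergent limit of the stream `u`. -/
def IsIdLimit (u : C1Stream C(Ω, ℝ)) (g : C(Ω, ℝ)) : Prop :=
  IsConvergentCauchy C1Stream.time u ∧ Tendsto u atTop (𝓝 g)

/-- The graph of the (partial) stream function of a module: `m.Outputs inp st w` says that the
module is defined on the values that its inputs receive and that its output is `w`. -/
def Node.Outputs (inp : ∀ i, Val Ω (inTy i)) (st : ∀ j, Val Ω (ty j)) :
    {σ : Channel} → Node Ω ty inTy σ → Val Ω σ → Prop
  | _, .constRealScalar c, w => (show ℝ from w) = c
  | _, .constFnScalar g, w => (show C(Ω, ℝ) from w) = g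
  | _, .constReal c, w => (show C1Stream ℝ from w) = C1Stream.const c
  | _, .constFn g, w => (show C1Stream C(Ω, ℝ) from w) = C1Stream.const g
  | _, .addReal u v, w => ∀ t : ℝ≥0,
      (show C1Stream ℝ from w) t
        = (show C1Stream ℝ from u.eval inp st) t + (show C1Stream ℝ from v.eval inp st) t
  | _, .addFn u v, w => ∀ t : ℝ≥0,
      (show C1Stream C(Ω, ℝ) from w) t
        = (show C1Stream C(Ω, ℝ) from u.eval inp st) t
          + (show C1Stream C(Ω, ℝ) from v.eval inp st) t
  | _, .mulReal u v, w => ∀ t : ℝ≥0,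
      (show C1Stream ℝ from w) t
        = (show C1Stream ℝ from u.eval inp st) t * (show C1Stream ℝ from v.eval inp st) t
  | _, .mulFn u v, w => ∀ t : ℝ≥0,
      (show C1Stream C(Ω, ℝ) from w) t
        = (show C1Stream C(Ω, ℝ) from u.eval inp st) t
          * (show C1Stream C(Ω, ℝ) from v.eval inp st) t
  | _, .integralReal c u v, w =>
      IsIntegralReal (c.eval inp st) (u.eval inp st) (v.eval inp st) w
  | _, .integralFn c u v, w =>
      IsIntegralFn (c.eval inp st) (u.eval inp st) (v.eval inp st) w
  | _, .limit u, w => IsIdLimit (u.eval inp st) w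

theorem C1Stream.ext_apply {E : Type} [AddCommGroup E] [Module ℝ E] [TopologicalSpace E]
    {u v : C1Stream E} (h : ∀ t, u t = v t) : u = v := by
  obtain ⟨u, hu⟩ := u
  obtain ⟨v, hv⟩ := v
  obtain rfl : u = v := ContinuousMap.ext h
  rfl

/-- `Node.Outputs` is the graph of a partial function. -/
theorem Node.outputs_unique {inp : ∀ i, Val Ω (inTy i)} {st : ∀ j, Val Ω (ty j)} {σ : Channel}
    {m : Node Ω ty inTy σ} {w w' : Val Ω σ} (h : m.Outputs inp st w) (h' : m.Outputs inp st w') :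
    w = w' := by
  cases m with
  | constRealScalar c => exact Eq.trans h (Eq.symm h')
  | constFnScalar g => exact Eq.trans h (Eq.symm h')
  | constReal c => exact Eq.trans h (Eq.symm h')
  | constFn g => exact Eq.trans h (Eq.symm h')
  | addReal u v => exact C1Stream.ext_apply fun t => (h t).trans (h' t).symm
  | addFn u v => exact C1Stream.ext_apply fun t => (h t).trans (h' t).symm
  | mulReal u v => exact C1Stream.ext_apply fun t => (h t).trans (h' t).symm
  | mulFn u v => exact C1Stream.ext_apply fun t => (h t).trans (h' t).symm
  | integralReal c u v => exact C1Stream.ext_apply fun t => (h t).trans (h' t).symm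
  | integralFn c u v =>
    exact C1Stream.ext_apply fun t => ContinuousMap.ext fun x => (h t x).trans (h' t x).symm
  | limit u => exact tendsto_nhds_unique (X := C(Ω, ℝ)) h.2 h'.2

/-- The modules whose output is connected to an input of the given module. -/
def Node.reads : {σ : Channel} → Node Ω ty inTy σ → Set (Fin n)
  | _, .constRealScalar _ => ∅
  | _, .constFnScalar _ => ∅
  | _, .constReal _ => ∅
  | _, .constFn _ => ∅
  | _, .addReal u v => u.reads ∪ v.reads
  | _, .addFn u v => u.reads ∪ v.reads
  | _, .mulReal u v => u.reads ∪ v.reads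
  | _, .mulFn u v => u.reads ∪ v.reads
  | _, .integralReal c u v => c.reads ∪ u.reads ∪ v.reads
  | _, .integralFn c u v => c.reads ∪ u.reads ∪ v.reads
  | _, .limit u => u.reads

/-- The elements of `C(Ω, ℝ)` that a module uses as a built-in constant. -/
def Node.fnConstants : {σ : Channel} → Node Ω ty inTy σ → Set C(Ω, ℝ)
  | _, .constFnScalar g => {g}
  | _, .constFn g => {g}
  | _, _ => ∅

/-- The module is a limit module. -/
def Node.IsLimit : {σ : Channel} → Node Ω ty inTy σ → Prop
  | _, .limit _ => True
  | _, _ => False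

end Semantics

namespace Network

variable {Ω : Set ℝ} (N : Network Ω)

/-- The space of values on the proper input channels. -/
abbrev Inputs : Type := ∀ i, Val Ω (N.inTy i)

/-- The space of values on the mixed and the proper output channels; there is one such channel
for each module, carrying its output. -/
abbrev State : Type := ∀ j, Val Ω (N.ty j)

/-- The graph of the induced operator: on the values `inp` of the proper inputs and `st` of the
module outputs, the modules of the network produce `st'`. Only the values of `st` on mixed
channels (those connected to an input of some module) are read. -/
def Induced (inp : N.Inputs) (st st' : N.State) : Prop :=
  ∀ j, (N.node j).Outputs inp st (st' j)

/-- The fixed point equation. -/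
def IsSolution (inp : N.Inputs) (st : N.State) : Prop := N.Induced inp st st

/-- Well-posedness on an open set `U` of inputs: existence, uniqueness and continuity of the
solution of the fixed point equation. -/
def WellPosedOn (U : Set N.Inputs) : Prop :=
  IsOpen U ∧ (∀ inp ∈ U, ∃! st : N.State, N.IsSolution inp st) ∧
    ∃ F : N.Inputs → N.State, ContinuousOn F U ∧ ∀ inp ∈ U, N.IsSolution inp (F inp)

/-- The network is well-posed on `U` and generates `F` there. -/
def Generates (U : Set N.Inputs) (F : N.Inputs → N.State) : Prop :=
  N.WellPosedOn U ∧ ∀ inp ∈ U, N.IsSolution inp (F inp)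

/-- In the state `st`, the output channel of the module `j` has type `σ` and carries `v`. -/
def Carries {N : Network Ω} (st : N.State) (j : Fin N.numModules) {σ : Channel} (v : Val Ω σ) :
    Prop :=
  (⟨N.ty j, st j⟩ : Σ σ, Val Ω σ) = ⟨σ, v⟩

/-- The output channel of the module `j` is a proper output: it is not connected to any input. -/
def IsProperOutput (j : Fin N.numModules) : Prop := ∀ i, j ∉ (N.node i).reads

/-- The network has no limit module. -/
def LimitFree : Prop := ∀ j, ¬ (N.node j).IsLimit

/-- All channels of the network are real. -/
def IsReal : Prop :=
  (∀ j, N.ty j = .realScalar ∨ N.ty j = .realStream) ∧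
    ∀ i, N.inTy i = .realScalar ∨ N.inTy i = .realStream

/-- The function-valued constants of the network all belong to `S` (real constants are not
restricted). -/
def ConstantsIn (S : Set C(Ω, ℝ)) : Prop := ∀ j, (N.node j).fnConstants ⊆ S

/-- The module `j` is an integrator with initial setting `c`, integrand `u` and integrator `v` in
the state `st`. -/
def IsIntegratorOf {N : Network Ω} (inp : N.Inputs) (st : N.State) (j : Fin N.numModules)
    (c : C(Ω, ℝ)) (u v : C1Stream C(Ω, ℝ)) : Prop :=
  ∃ c₀ : Source N.ty N.inTy .fnScalar, ∃ u₀ v₀ : Source N.ty N.inTy .fnStream,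
    (⟨N.ty j, N.node j⟩ : Σ σ, Node Ω N.ty N.inTy σ) = ⟨.fnStream, .integralFn c₀ u₀ v₀⟩ ∧
    c₀.eval inp st = c ∧ u₀.eval inp st = u ∧ v₀.eval inp st = v

/-- The module `j` is a limit module which receives the stream `u` in the state `st`. -/
def IsLimitOf {N : Network Ω} (inp : N.Inputs) (st : N.State) (j : Fin N.numModules)
    (u : C1Stream C(Ω, ℝ)) : Prop :=
  ∃ u₀ : Source N.ty N.inTy .fnStream,
    (⟨N.ty j, N.node j⟩ : Σ σ, Node Ω N.ty N.inTy σ) = ⟨.fnScalar, .limit u₀⟩ ∧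
    u₀.eval inp st = u

end Network

/-- A network with no input but time and without limit modules, whose function-valued constants
belong to `S`, generates the stream `u`. -/
def IsGPACGenerable {Ω : Set ℝ} (S : Set C(Ω, ℝ)) (u : C1Stream C(Ω, ℝ)) : Prop :=
  ∃ N : Network Ω, N.numInputs = 0 ∧ N.LimitFree ∧ N.ConstantsIn S ∧
    ∃ F : N.Inputs → N.State, N.Generates univ F ∧
      ∃ j, ∀ inp, Network.Carries (F inp) j (σ := .fnStream) u

/-- A real network (a Shannon GPAC) with no input but time generates the real stream `T`. -/
def IsShannonGenerable (T : C1Stream ℝ) : Prop :=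
  ∃ N : Network univ, N.numInputs = 0 ∧ N.IsReal ∧
    ∃ F : N.Inputs → N.State, N.Generates univ F ∧
      ∃ j, ∀ inp, Network.Carries (F inp) j (σ := .realStream) T

/-- An effective continuous modulus of convergence. -/
def IsEffectiveModulus (T : C1Stream ℝ) : Prop :=
  Monotone T ∧ IsShannonGenerable T

/-- The integrand `sin(x arctan t) / ((1 + t²)^(x/2) (e^(π t) + 1))`. -/
def zetaIntegrand (t x : ℝ) : ℝ :=
  Real.sin (x * Real.arctan t) / ((1 + t ^ 2) ^ (x / 2) * (Real.exp (Real.pi * t) + 1))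

end LGPAC

end

/-!
The integral formula is Jensen's. Since `(1 - i t) ^ (-x)` has imaginary part
`sin (x arctan t) / (1 + t ^ 2) ^ (x / 2)`, the Gamma integral gives
`Γ(x) sin (x arctan t) / (1 + t ^ 2) ^ (x / 2) = ∫ u ^ (x - 1) exp (-u) sin (u t) du`. Dividing by
`exp (π t) + 1`, integrating over `t` and interchanging the integrals reduces the formula to
`∫ sin (u t) / (exp (π t) + 1) dt = 1 / (2 u) - 1 / (2 sinh u)` (`integral_sin_div_exp_add_one`), which
is the partial fraction expansion of `1 / sinh u` (`hasSum_csch`). The term `1 / (2 u)` produces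
`2 ^ (x - 1) / (x - 1)`, and expanding `exp (-u) / (2 sinh u)` in powers of `exp (-2 u)` produces the
Dirichlet series (`zeta_integral_formula`).

The integrand is at most `exp (-π t) (1 + t ^ 2) ^ (-x / 2)`. For `τ ≥ 1` the tail of `2 ^ x ∫ ζ₂`
beyond `τ` is therefore at most `exp (-π τ) / π * 2 ^ (x / 2)`, the weights `2 ^ (-n)` of the metric sum
this to less than `2 ^ (-τ)`, and for `τ < 1` nothing has to be shown, as all distances in
`C([2, ∞), ℝ)` are at most `1 / 2` (`isConvergentCauchy_of_zetaIntegrand`).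

The integrand is a product of solutions of polynomial differential equations: `r = 1 / (1 + t ^ 2)` and
`e = 1 / (exp (π t) + 1)` solve scalar quadratic equations, and the real and imaginary parts of
`(1 - i t) ^ (-x)` solve a linear system with coefficients built from `x`, `t` and `r`. The feedback
loops of `zetaNetwork` realise these equations. For well-posedness it has to be shown that they have no
other solution (`feedback_unique`): the difference `Y` of two solutions, or the squared distance in the
case of the system, satisfies a homogeneous linear equation `Y' = g Y` with `Y 0 = 0`, so it vanishes.
All other modules are determined by the outputs of those loops (`eq_zetaState_of_isSolution`).
-/

noncomputable section

namespace LGPAC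

/-! ### Partial fractions -/

/-- The partial fraction expansion of `coth u - 1 / u`: Mathlib's expansion of the cotangent at
`z = i u / π`. -/
theorem hasSum_coth {u : ℝ} (hu : 0 < u) :
    HasSum (fun n : ℕ => 2 * u / (u ^ 2 + ((n + 1) * Real.pi) ^ 2))
      (Real.cosh u / Real.sinh u - 1 / u) := by
  have hpi := Real.pi_pos
  set z : ℂ := (u / Real.pi : ℝ) * Complex.I with hz
  have hzc : z ∈ Complex.integerComplement := by
    rintro ⟨n, hn⟩
    have := congrArg Complex.im hn
    have hq : u / Real.pi ≠ 0 := by positivity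
    exact hq (by simpa [hz] using this.symm)
  have h1 := (summable_cotTerm hzc).hasSum
  have h2 := cot_series_rep' hzc
  simp only [cotTerm] at h1
  rw [← h2] at h1
  have h3 : (Real.pi : ℂ) * z = u * Complex.I := by
    have : (Real.pi : ℂ) ≠ 0 := by exact_mod_cast hpi.ne'
    rw [hz]; push_cast; field_simp
  have hs : Complex.sinh u ≠ 0 := by
    rw [← Complex.ofReal_sinh]; exact_mod_cast (Real.sinh_pos_iff.2 hu).ne'
  have h4 := h1.mul_left (Complex.I / Real.pi)
  rw [h3, Complex.cot, Complex.cos_mul_I, Complex.sin_mul_I] at h4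
  rw [← Complex.hasSum_ofReal]
  have hpc : (Real.pi : ℂ) ≠ 0 := by exact_mod_cast hpi.ne'
  have huc : (u : ℂ) ≠ 0 := by exact_mod_cast hu.ne'
  convert! h4 using 1
  · ext n
    have ha : z - (n + 1) ≠ 0 := by
      have := Complex.integerComplement_add_ne_zero hzc (-((n:ℤ)+1))
      push_cast at this; convert this using 1; ring
    have hb : z + (n + 1) ≠ 0 := by
      have := Complex.integerComplement_add_ne_zero hzc ((n:ℤ)+1)
      push_cast at this; exact this
    have hd : (u : ℂ) ^ 2 + ((n + 1) * Real.pi) ^ 2 ≠ 0 := by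
      have : (0:ℝ) < u ^ 2 + ((n + 1) * Real.pi) ^ 2 := by positivity
      exact_mod_cast this.ne'
    have hzu : (u : ℂ) = - Complex.I * Real.pi * z := by
      rw [mul_assoc, h3]; linear_combination (u:ℂ) * Complex.I_sq
    push_cast
    have e1 : (u : ℂ) ^ 2 + ((n + 1) * Real.pi) ^ 2 =
        -Real.pi ^ 2 * ((z - (n + 1)) * (z + (n + 1))) := by
      rw [hzu]; linear_combination (Real.pi : ℂ)^2 * z^2 * Complex.I_sq
    rw [e1, hzu]
    field_simp
    ring
  · push_cast
    rw [hz]; push_cast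
    field_simp

theorem hasSum_alternating {a : ℕ → ℝ} {S O : ℝ} (h : HasSum a S)
    (ho : HasSum (fun k => a (2 * k + 1)) O) :
    HasSum (fun n => (-1) ^ n * a n) (S - 2 * O) := by
  obtain ⟨E, he⟩ : Summable fun k => a (2 * k) :=
    h.summable.comp_injective (mul_right_injective₀ two_ne_zero)
  have hS : E + O = S := (he.even_add_odd ho).unique h
  have hval : E + -O = S - 2 * O := by rw [← hS]; ring
  rw [← hval]
  refine HasSum.even_add_odd ?_ ?_
  · simpa only [pow_mul, neg_one_sq, one_pow, one_mul] using he
  · refine ho.neg.congr_fun fun k => ?_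
    rw [pow_succ, pow_mul]
    simp

/-- The partial fraction expansion of `1 / sinh u`, from `1 / sinh u = coth (u / 2) - coth u`: the
terms of odd index add up to a multiple of the expansion of `coth (u / 2)`. -/
theorem hasSum_csch {u : ℝ} (hu : 0 < u) :
    HasSum (fun n : ℕ => (-1) ^ n * (u / (u ^ 2 + ((n + 1) * Real.pi) ^ 2)))
      (1 / (2 * u) - 1 / (2 * Real.sinh u)) := by
  have h1 : HasSum (fun n : ℕ => u / (u ^ 2 + ((n + 1) * Real.pi) ^ 2))
      (1 / 2 * (Real.cosh u / Real.sinh u - 1 / u)) := by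
    refine ((hasSum_coth hu).mul_left (1 / 2)).congr_fun fun n => ?_
    ring
  have h2 : HasSum (fun k : ℕ => u / (u ^ 2 + (((2 * k + 1 : ℕ) + 1) * Real.pi) ^ 2))
      (1 / 4 * (Real.cosh (u / 2) / Real.sinh (u / 2) - 1 / (u / 2))) := by
    refine ((hasSum_coth (half_pos hu)).mul_left (1 / 4)).congr_fun fun k => ?_
    have h₁ : (0 : ℝ) < (u / 2) ^ 2 + ((k + 1) * Real.pi) ^ 2 := by positivity
    have h₂ : (0 : ℝ) < u ^ 2 + (((2 * k + 1 : ℕ) + 1) * Real.pi) ^ 2 := by positivity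
    push_cast at *
    field_simp
    ring
  convert! hasSum_alternating h1 h2 using 1
  have hc : Real.cosh u = 2 * Real.cosh (u / 2) ^ 2 - 1 := by
    have h := Real.cosh_two_mul (u / 2)
    have h' := Real.cosh_sq_sub_sinh_sq (u / 2)
    rw [mul_div_cancel₀ _ two_ne_zero] at h
    linarith
  have hs : Real.sinh u = 2 * Real.sinh (u / 2) * Real.cosh (u / 2) := by
    have h := Real.sinh_two_mul (u / 2)
    rwa [mul_div_cancel₀ _ two_ne_zero] at h
  have hs₀ : 0 < Real.sinh (u / 2) := Real.sinh_pos_iff.2 (half_pos hu)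
  have hc₀ := Real.cosh_pos (u / 2)
  rw [hs, hc]
  field_simp
  ring

theorem integral_sin_mul_exp {a : ℝ} (ha : 0 < a) (u : ℝ) :
    IntegrableOn (fun t : ℝ => Real.sin (u * t) * Real.exp (-(a * t))) (Ioi 0) ∧
    ∫ t in Ioi (0:ℝ), Real.sin (u * t) * Real.exp (-(a * t)) = u / (u ^ 2 + a ^ 2) := by
  have hre : (-(a:ℂ) + u * Complex.I).re < 0 := by simpa using ha
  have h := integral_exp_mul_complex_Ioi hre 0
  have hi := integrableOn_exp_mul_complex_Ioi hre 0
  have e : ∀ t : ℝ, Real.sin (u * t) * Real.exp (-(a * t)) =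
      (Complex.exp ((-(a:ℂ) + u * Complex.I) * t)).im := fun t => by
    rw [Complex.exp_im]; simp; ring
  have h2 : a^2 + u^2 ≠ 0 := by positivity
  refine ⟨by simpa only [e] using! hi.im, ?_⟩
  simp_rw [e]
  have := integral_im (𝕜 := ℂ) hi
  simp only [RCLike.im_to_complex] at this
  rw [this, h]
  simp [Complex.div_im, Complex.normSq_apply, Complex.neg_im]
  rw [add_comm (a * a)]
  ring_nf

/-! ### Jensen's integral formula -/

theorem integrableOn_rpow_mul_exp_neg_mul {s a : ℝ} (hs : 0 < s) (ha : 0 < a) :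
    IntegrableOn (fun t : ℝ => t ^ (s - 1) * Real.exp (-(a * t))) (Ioi 0) := by
  have h := integrableOn_rpow_mul_exp_neg_mul_rpow (p := 1) (s := s - 1) (b := a) (by linarith)
    one_pos ha
  simpa only [Real.rpow_one, neg_mul] using h

/-- Expand `1 / (exp (π t) + 1) = ∑ (-1) ^ n exp (-(n + 1) π t)` and integrate term by term. -/
theorem integral_sin_div_exp_add_one {u : ℝ} (hu : 0 < u) :
    ∫ t in Ioi (0 : ℝ), Real.sin (u * t) / (Real.exp (Real.pi * t) + 1) =
      1 / (2 * u) - 1 / (2 * Real.sinh u) := by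
  have hpi := Real.pi_pos
  set F : ℕ → ℝ → ℝ := fun n t =>
    (-1) ^ n * (Real.sin (u * t) * Real.exp (-((n + 1) * Real.pi * t))) with hF
  have ha : ∀ n : ℕ, 0 < (n + 1) * Real.pi := fun n => by positivity
  have hint : ∀ n, IntegrableOn (F n) (Ioi 0) := fun n =>
    (integral_sin_mul_exp (ha n) u).1.const_mul _
  have hbound : ∀ n, ∫ t in Ioi (0 : ℝ), ‖F n t‖ ≤ u / Real.pi ^ 2 * (1 / ((n : ℝ) + 1) ^ 2) := by
    intro n
    have hi := (integrableOn_rpow_mul_exp_neg_mul two_pos (ha n)).const_mul u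
    have hv := Real.integral_rpow_mul_exp_neg_mul_Ioi two_pos (ha n)
    have h2 : ∫ t in Ioi (0 : ℝ), u * (t ^ ((2 : ℝ) - 1) * Real.exp (-((n + 1) * Real.pi * t))) =
        u / Real.pi ^ 2 * (1 / ((n : ℝ) + 1) ^ 2) := by
      rw [integral_const_mul, hv, Real.Gamma_two, Real.rpow_two]
      field_simp
    rw [← h2]
    refine setIntegral_mono_on (hint n).norm hi measurableSet_Ioi fun t ht => ?_
    have ht : 0 < t := ht
    -- `|sin (u t)| ≤ u t` gains a power of `n`, which makes the sum of the integrals converge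
    have hsin : |Real.sin (u * t)| ≤ u * t :=
      (Real.abs_sin_le_abs (x := u * t)).trans_eq (abs_of_pos (by positivity))
    simp only [hF, norm_mul, norm_pow, norm_neg, norm_one, one_pow, one_mul, Real.norm_eq_abs,
      Real.abs_exp]
    rw [show (2 : ℝ) - 1 = 1 by norm_num, Real.rpow_one, ← mul_assoc]
    gcongr
  have hsum : Summable fun n => ∫ t in Ioi (0 : ℝ), ‖F n t‖ := by
    refine Summable.of_nonneg_of_le (fun n => integral_nonneg fun t => norm_nonneg _) hbound ?_
    refine Summable.mul_left _ ?_
    have := (summable_nat_add_iff 1).2 (Real.summable_one_div_nat_pow.2 one_lt_two)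
    simpa using this
  have key := hasSum_integral_of_summable_integral_norm hint hsum
  have hvals : HasSum (fun n => ∫ t in Ioi (0 : ℝ), F n t)
      (1 / (2 * u) - 1 / (2 * Real.sinh u)) := by
    refine (hasSum_csch hu).congr_fun fun n => ?_
    rw [← (integral_sin_mul_exp (ha n) u).2]
    exact integral_const_mul _ _
  rw [hvals.unique key]
  refine setIntegral_congr_fun measurableSet_Ioi fun t ht => ?_
  have ht : 0 < t := ht
  have he : Real.exp (-(Real.pi * t)) < 1 :=
    Real.exp_zero ▸ Real.exp_lt_exp.2 (by nlinarith)
  have hg := (hasSum_geometric_of_abs_lt_one (r := -Real.exp (-(Real.pi * t)))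
    (by rw [abs_neg, Real.abs_exp]; exact he)).mul_left
      (Real.sin (u * t) * Real.exp (-(Real.pi * t)))
  refine Eq.trans ?_ (hg.congr_fun fun n => ?_).tsum_eq.symm
  · rw [Real.exp_neg, sub_neg_eq_add]
    have := Real.exp_pos (Real.pi * t)
    field_simp
  · simp only [hF]
    rw [neg_pow (Real.exp _), ← Real.exp_nat_mul,
      show -((n + 1) * Real.pi * t) = -(Real.pi * t) + n * -(Real.pi * t) by ring, Real.exp_add]
    ring

/-- The polar form of `1 / (1 - i t)`. -/
theorem one_div_one_sub_mul_I (t : ℝ) :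
    1 / (1 - t * Complex.I) =
      Complex.exp ((-(Real.log (1 + t ^ 2) / 2) : ℝ) + (Real.arctan t : ℝ) * Complex.I) := by
  have h0 : (0 : ℝ) < 1 + t ^ 2 := by positivity
  have hs : Real.exp (-(Real.log (1 + t ^ 2) / 2)) = 1 / √(1 + t ^ 2) := by
    rw [Real.sqrt_eq_rpow, Real.rpow_def_of_pos h0, one_div, ← Real.exp_neg]
    ring_nf
  have hsq : √(1 + t ^ 2) * √(1 + t ^ 2) = 1 + t ^ 2 := Real.mul_self_sqrt h0.le
  have hne : (1 : ℂ) - t * Complex.I ≠ 0 := fun h => by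
    simpa using congrArg Complex.re h
  rw [Complex.exp_add, ← Complex.ofReal_exp, Complex.exp_mul_I, ← Complex.ofReal_cos,
    ← Complex.ofReal_sin, hs, Real.cos_arctan, Real.sin_arctan, div_eq_iff hne]
  have hp : 0 < √(1 + t ^ 2) := Real.sqrt_pos.2 h0
  apply Complex.ext <;> simp <;> field_simp
  · linear_combination hsq
  · ring

/-- The Gamma integral with a complex rate `r`: both sides are holomorphic in the right half-plane
and agree for real `r`. -/
theorem integral_rpow_mul_cexp_neg_mul {x : ℝ} (hx : 0 < x) {r : ℂ} (hr : 0 < r.re) :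
    ∫ u in Ioi (0 : ℝ), ((u ^ (x - 1) : ℝ) : ℂ) * Complex.exp (-(r * u)) =
      (1 / r) ^ (x : ℂ) * Complex.Gamma x := by
  set U : Set ℂ := {r | 0 < r.re} with hU
  have hUo : IsOpen U := isOpen_lt continuous_const Complex.continuous_re
  have hmeas : ∀ r : ℂ, AEStronglyMeasurable
      (fun u : ℝ => ((u ^ (x - 1) : ℝ) : ℂ) * Complex.exp (-(r * u)))
      (volume.restrict (Ioi 0)) := fun r => by
    refine Measurable.aestronglyMeasurable ?_
    fun_prop
  have hnorm : ∀ (r : ℂ) (u : ℝ), ‖Complex.exp (-(r * u))‖ = Real.exp (-(r.re * u)) := fun r u => by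
    rw [Complex.norm_exp]; simp
  have hdiff : DifferentiableOn ℂ (fun r : ℂ => ∫ u in Ioi (0 : ℝ),
      ((u ^ (x - 1) : ℝ) : ℂ) * Complex.exp (-(r * u))) U := by
    intro r hr
    have hr : 0 < r.re := hr
    have hball : ∀ z ∈ Metric.ball r (r.re / 2), r.re / 2 ≤ z.re := fun z hz => by
      have h1 := (Complex.abs_re_le_norm (z - r)).trans_lt (mem_ball_iff_norm.1 hz)
      rw [Complex.sub_re, abs_lt] at h1
      linarith
    refine (hasDerivAt_integral_of_dominated_loc_of_deriv_le
      (F' := fun z u => ((u ^ (x - 1) : ℝ) : ℂ) * (Complex.exp (-(z * u)) * (-(1 * u))))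
      (bound := fun u => u ^ (x + 1 - 1) * Real.exp (-(r.re / 2 * u)))
      (Metric.ball_mem_nhds r (half_pos hr)) (Eventually.of_forall hmeas) ?_ ?_ ?_
      (integrableOn_rpow_mul_exp_neg_mul (by linarith) (half_pos hr))
      ?_).2.differentiableAt.differentiableWithinAt
    · refine (integrableOn_rpow_mul_exp_neg_mul hx hr).mono' (hmeas r) ?_
      filter_upwards [self_mem_ae_restrict measurableSet_Ioi] with u hu
      have hu : 0 < u := hu
      rw [norm_mul, hnorm, Complex.norm_real, Real.norm_of_nonneg (by positivity)]
    · refine Measurable.aestronglyMeasurable ?_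
      fun_prop
    · filter_upwards [self_mem_ae_restrict measurableSet_Ioi] with u hu z hz
      have hu : 0 < u := hu
      have h1 := hball z hz
      rw [norm_mul, norm_mul, hnorm, Complex.norm_real, Real.norm_of_nonneg (by positivity),
        one_mul, norm_neg, Complex.norm_real, Real.norm_of_nonneg hu.le, mul_comm (Real.exp _),
        ← mul_assoc, add_sub_right_comm, Real.rpow_add_one hu.ne']
      gcongr
    · refine Eventually.of_forall fun u z _ => ?_
      exact (((hasDerivAt_id z).mul_const (u : ℂ)).neg.cexp).const_mul _
  have hslit : ∀ z ∈ U, 1 / z ∈ Complex.slitPlane := fun z hz => by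
    left
    rw [one_div, Complex.inv_re]
    exact div_pos hz (Complex.normSq_pos.2 fun h => by simp [hU, h] at hz)
  have hdiff' : DifferentiableOn ℂ (fun r : ℂ => (1 / r) ^ (x : ℂ) * Complex.Gamma x) U := by
    refine DifferentiableOn.mul_const (DifferentiableOn.cpow ?_ (differentiableOn_const _) hslit) _
    exact (differentiableOn_const _).div differentiableOn_id fun z hz h => by simp [hU, h] at hz
  refine (hdiff.analyticOnNhd hUo).eqOn_of_preconnected_of_frequently_eq
    (hdiff'.analyticOnNhd hUo) (convex_halfSpace_re_gt 0).isPreconnected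
    (z₀ := 1) (by simp [hU]) ?_ hr
  -- on the real axis the formula is the classical one
  have hreal : ∀ r : ℝ, 0 < r → ∫ u in Ioi (0 : ℝ), ((u ^ (x - 1) : ℝ) : ℂ) *
      Complex.exp (-((r : ℂ) * u)) = (1 / (r : ℂ)) ^ (x : ℂ) * Complex.Gamma x := fun r hr => by
    rw [← Complex.integral_cpow_mul_exp_neg_mul_Ioi (by simpa using hx) hr]
    refine setIntegral_congr_fun measurableSet_Ioi fun u hu => ?_
    simp only [Complex.ofReal_cpow (le_of_lt hu)]
    push_cast
    rfl
  have hto : Tendsto (fun s : ℝ => (s : ℂ)) (𝓝[>] 1) (𝓝[≠] 1) := by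
    refine tendsto_nhdsWithin_of_tendsto_nhds_of_eventually_within _ ?_ ?_
    · exact (Complex.continuous_ofReal.tendsto' 1 1 rfl).mono_left nhdsWithin_le_nhds
    · filter_upwards [self_mem_nhdsWithin] with s hs
      exact fun h => (ne_of_gt (show 1 < s from hs)) (Complex.ofReal_eq_one.1 h)
  refine hto.frequently (Eventually.frequently ?_)
  filter_upwards [self_mem_nhdsWithin] with s hs
  exact hreal s (one_pos.trans (show 1 < s from hs))

/-- The imaginary part of the Gamma integral with rate `1 - i t`. -/
theorem integral_rpow_mul_exp_neg_mul_sin {x : ℝ} (hx : 0 < x) (t : ℝ) :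
    ∫ u in Ioi (0 : ℝ), u ^ (x - 1) * Real.exp (-u) * Real.sin (u * t) =
      Real.Gamma x * (Real.sin (x * Real.arctan t) / (1 + t ^ 2) ^ (x / 2)) := by
  have hre : 0 < (1 - t * Complex.I).re := by simp
  have h := integral_rpow_mul_cexp_neg_mul hx hre
  have h0 : (0 : ℝ) < 1 + t ^ 2 := by positivity
  have him0 : ((-(Real.log (1 + t ^ 2) / 2) : ℝ) + (Real.arctan t : ℝ) * Complex.I).im =
      Real.arctan t := by
    rw [Complex.add_im, Complex.ofReal_im, Complex.im_ofReal_mul, Complex.I_im]; ring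
  have hlog : Complex.log (1 / (1 - t * Complex.I)) =
      (-(Real.log (1 + t ^ 2) / 2) : ℝ) + (Real.arctan t : ℝ) * Complex.I := by
    rw [one_div_one_sub_mul_I, Complex.log_exp]
    · rw [him0]; linarith [Real.neg_pi_div_two_lt_arctan t, Real.pi_pos]
    · rw [him0]; linarith [Real.arctan_lt_pi_div_two t, Real.pi_pos]
  have hne : 1 / (1 - t * Complex.I) ≠ 0 := by
    rw [one_div_one_sub_mul_I]; exact Complex.exp_ne_zero _
  -- the integrand is integrable, since otherwise its integral would be `0`
  have hi : IntegrableOn (fun u : ℝ => ((u ^ (x - 1) : ℝ) : ℂ) *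
      Complex.exp (-((1 - t * Complex.I) * u))) (Ioi 0) := by
    by_contra hcon
    rw [integral_undef hcon] at h
    exact mul_ne_zero (fun h => hne ((Complex.cpow_eq_zero_iff _ _).1 h).1)
      (Complex.Gamma_ne_zero_of_re_pos (by simpa using hx)) h.symm
  have him := integral_im (𝕜 := ℂ) hi
  simp only [RCLike.im_to_complex] at him
  have hexp : (((-(Real.log (1 + t ^ 2) / 2) : ℝ) : ℂ) + (Real.arctan t : ℝ) * Complex.I) * (x : ℂ)
      = ((-(Real.log (1 + t ^ 2) / 2) * x : ℝ) : ℂ) + ((x * Real.arctan t : ℝ) : ℂ) * Complex.I := by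
    push_cast; ring
  rw [h, Complex.cpow_def_of_ne_zero hne, hlog, hexp, Complex.Gamma_ofReal, Complex.im_mul_ofReal,
    Complex.exp_add, ← Complex.ofReal_exp, Complex.im_ofReal_mul, Complex.exp_ofReal_mul_I_im] at him
  rw [Real.rpow_def_of_pos h0, div_eq_mul_inv, ← Real.exp_neg]
  refine Eq.trans ?_ (him.trans (by ring_nf))
  refine setIntegral_congr_fun measurableSet_Ioi fun u _ => ?_
  have e : -((1 - t * Complex.I) * u) = ((-u : ℝ) : ℂ) + ((u * t : ℝ) : ℂ) * Complex.I := by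
    push_cast; ring
  simp only [e]
  rw [Complex.im_ofReal_mul, Complex.exp_add, ← Complex.ofReal_exp, Complex.im_ofReal_mul,
    Complex.exp_ofReal_mul_I_im, mul_assoc]

/-- Expand `exp (-u) / (2 sinh u) = ∑ exp (-2 (n + 1) u)` and integrate term by term. -/
theorem integral_rpow_mul_exp_neg_div_sinh {x : ℝ} (hx : 1 < x) :
    ∫ u in Ioi (0 : ℝ), u ^ (x - 1) * Real.exp (-u) / (2 * Real.sinh u) =
      Real.Gamma x * (2 ^ (-x) * ∑' n : ℕ, 1 / ((n : ℝ) + 1) ^ x) := by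
  have hx0 : 0 < x := one_pos.trans hx
  set F : ℕ → ℝ → ℝ := fun n u => u ^ (x - 1) * Real.exp (-(2 * (n + 1) * u)) with hF
  have ha : ∀ n : ℕ, (0 : ℝ) < 2 * (n + 1) := fun n => by positivity
  have hint : ∀ n, IntegrableOn (F n) (Ioi 0) := fun n =>
    integrableOn_rpow_mul_exp_neg_mul hx0 (ha n)
  have hval : ∀ n, ∫ u in Ioi (0 : ℝ), F n u =
      Real.Gamma x * 2 ^ (-x) * (1 / ((n : ℝ) + 1) ^ x) := fun n => by
    have hn : (0 : ℝ) < n + 1 := by positivity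
    rw [Real.integral_rpow_mul_exp_neg_mul_Ioi hx0 (ha n), one_div, Real.inv_rpow (ha n).le,
      Real.mul_rpow two_pos.le hn.le, Real.rpow_neg two_pos.le]
    field_simp
  have hnorm : ∀ n, ∫ u in Ioi (0 : ℝ), ‖F n u‖ = ∫ u in Ioi (0 : ℝ), F n u := fun n => by
    refine setIntegral_congr_fun measurableSet_Ioi fun u hu => Real.norm_of_nonneg ?_
    have hu : 0 < u := hu
    positivity
  have hz : Summable fun n : ℕ => 1 / ((n : ℝ) + 1) ^ x := by
    have := (summable_nat_add_iff 1).2 (Real.summable_one_div_nat_rpow.2 hx)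
    simpa using this
  have key := hasSum_integral_of_summable_integral_norm hint (by
    simp only [hnorm, hval]; exact hz.mul_left _)
  simp only [hval] at key
  rw [← mul_assoc, ← tsum_mul_left, key.tsum_eq]
  refine setIntegral_congr_fun measurableSet_Ioi fun u hu => ?_
  have hu : 0 < u := hu
  have he : Real.exp (-(2 * u)) < 1 := Real.exp_zero ▸ Real.exp_lt_exp.2 (by linarith)
  have hg := (hasSum_geometric_of_lt_one (Real.exp_pos _).le he).mul_left
    (u ^ (x - 1) * Real.exp (-(2 * u)))
  refine Eq.trans ?_ (hg.congr_fun fun n => ?_).tsum_eq.symm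
  · have h1 : 1 < Real.exp u := Real.one_lt_exp_iff.2 hu
    have h2 : Real.exp (-(2 * u)) = (Real.exp u * Real.exp u)⁻¹ := by
      rw [Real.exp_neg, ← Real.exp_add]; ring_nf
    have h3 : Real.exp u * Real.exp u - 1 ≠ 0 := by nlinarith
    have h4 : Real.exp u ^ 2 - 1 ≠ 0 := by nlinarith
    rw [Real.sinh_eq, h2, Real.exp_neg]
    field_simp
  · simp only [hF]
    rw [← Real.exp_nat_mul, mul_assoc (u ^ (x - 1)), ← Real.exp_add]
    ring_nf

/-- Jensen's integral formula for the zeta function. The double integral of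
`u ^ (x - 1) exp (-u) sin (u t) / (exp (π t) + 1)` is evaluated in both orders. -/
theorem zeta_integral_formula {x : ℝ} (hx : 1 < x) :
    IntegrableOn (fun t : ℝ => zetaIntegrand t x) (Ioi 0) ∧
    riemannZeta x = (((2 : ℝ) ^ (x - 1) / (x - 1) -
      2 ^ x * ∫ t in Ioi (0 : ℝ), zetaIntegrand t x : ℝ) : ℂ) := by
  have hx0 : 0 < x := one_pos.trans hx
  have hpi := Real.pi_pos
  have hG : 0 < Real.Gamma x := Real.Gamma_pos_of_pos hx0
  set f : ℝ → ℝ → ℝ := fun t u =>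
    u ^ (x - 1) * Real.exp (-u) * (Real.sin (u * t) / (Real.exp (Real.pi * t) + 1)) with hf
  have hexp : IntegrableOn (fun t : ℝ => Real.exp (-(Real.pi * t))) (Ioi 0) := by
    simpa using integrableOn_rpow_mul_exp_neg_mul one_pos hpi
  have hgam : IntegrableOn (fun u : ℝ => u ^ (x - 1) * Real.exp (-u)) (Ioi 0) := by
    simpa using integrableOn_rpow_mul_exp_neg_mul hx0 one_pos
  have hfi : Integrable (Function.uncurry f)
      ((volume.restrict (Ioi 0)).prod (volume.restrict (Ioi 0))) := by
    refine (Integrable.mul_prod hexp hgam).mono' ?_ ?_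
    · refine Measurable.aestronglyMeasurable ?_
      simp only [hf, Function.uncurry_def]
      fun_prop
    · rw [Measure.prod_restrict]
      filter_upwards [self_mem_ae_restrict (measurableSet_Ioi.prod measurableSet_Ioi)] with p hp
      have hu : 0 < p.2 := hp.2
      have h1 : |Real.sin (p.2 * p.1) / (Real.exp (Real.pi * p.1) + 1)| ≤
          Real.exp (-(Real.pi * p.1)) := by
        have := Real.exp_pos (Real.pi * p.1)
        rw [abs_div, abs_of_pos (by positivity : 0 < Real.exp (Real.pi * p.1) + 1), Real.exp_neg,
          ← one_div]
        gcongr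
        · exact Real.abs_sin_le_one _
        · linarith
      simp only [hf, Function.uncurry_def, norm_mul, Real.norm_eq_abs]
      rw [abs_of_nonneg (by positivity : 0 ≤ p.2 ^ (x - 1)), Real.abs_exp,
        mul_comm (Real.exp _)]
      gcongr
  have hin : ∀ t, ∫ u in Ioi (0 : ℝ), f t u = Real.Gamma x * zetaIntegrand t x := fun t => by
    have h : ∀ u, f t u = (u ^ (x - 1) * Real.exp (-u) * Real.sin (u * t)) *
        (1 / (Real.exp (Real.pi * t) + 1)) := fun u => by simp only [hf]; ring
    simp only [h]
    rw [integral_mul_const, integral_rpow_mul_exp_neg_mul_sin hx0, zetaIntegrand]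
    rw [mul_assoc, div_mul_div_comm, mul_one]
  have hout : ∀ u ∈ Ioi (0 : ℝ), ∫ t in Ioi (0 : ℝ), f t u =
      1 / 2 * (u ^ (x - 1 - 1) * Real.exp (-(1 * u))) -
        u ^ (x - 1) * Real.exp (-u) / (2 * Real.sinh u) := fun u hu => by
    have hu : 0 < u := hu
    simp only [hf]
    rw [integral_const_mul, integral_sin_div_exp_add_one hu, Real.rpow_sub_one hu.ne' (x - 1),
      one_mul]
    field_simp
  have hint1 : Integrable (fun t => Real.Gamma x * zetaIntegrand t x)
      (volume.restrict (Ioi 0)) := by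
    simpa only [Function.uncurry_apply_pair, hin] using hfi.integral_prod_left
  have hint2 : IntegrableOn (fun u => 1 / 2 * (u ^ (x - 1 - 1) * Real.exp (-(1 * u))) -
        u ^ (x - 1) * Real.exp (-u) / (2 * Real.sinh u)) (Ioi 0) :=
    IntegrableOn.congr_fun (hfi.integral_prod_right) hout measurableSet_Ioi
  have hint3 : IntegrableOn (fun u => 1 / 2 * (u ^ (x - 1 - 1) * Real.exp (-(1 * u)))) (Ioi 0) :=
    (integrableOn_rpow_mul_exp_neg_mul (by linarith) one_pos).const_mul _
  have hint4 : IntegrableOn (fun u => u ^ (x - 1) * Real.exp (-u) / (2 * Real.sinh u)) (Ioi 0) := by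
    exact (hint3.sub hint2).congr_fun (fun u _ => by simp) measurableSet_Ioi
  have hswap := integral_integral_swap hfi
  simp only [hin] at hswap
  rw [setIntegral_congr_fun measurableSet_Ioi hout, integral_sub hint3 hint4, integral_const_mul,
    integral_const_mul, Real.integral_rpow_mul_exp_neg_mul_Ioi (by linarith) one_pos,
    integral_rpow_mul_exp_neg_div_sinh hx] at hswap
  have hGx : Real.Gamma x = (x - 1) * Real.Gamma (x - 1) := by
    have := Real.Gamma_add_one (s := x - 1) (by linarith)
    rwa [sub_add_cancel] at this
  refine ⟨?_, ?_⟩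
  · have := hint1.const_mul (Real.Gamma x)⁻¹
    simpa only [inv_mul_cancel_left₀ hG.ne'] using! this
  · have hz : riemannZeta x = ((∑' n : ℕ, 1 / ((n : ℝ) + 1) ^ x : ℝ) : ℂ) := by
      rw [zeta_eq_tsum_one_div_nat_add_one_cpow (by simpa using hx), Complex.ofReal_tsum]
      refine tsum_congr fun n => ?_
      rw [Complex.ofReal_div, Complex.ofReal_cpow (by positivity)]
      push_cast
      rfl
    rw [hz]
    congr 1
    have h2 : (2 : ℝ) ^ x * 2 ^ (-x) = 1 := by
      rw [← Real.rpow_add two_pos, add_neg_cancel, Real.rpow_zero]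
    have hx1 : x - 1 ≠ 0 := by linarith
    have hdiv : 1 / 2 * Real.Gamma (x - 1) = Real.Gamma x * (1 / (2 * (x - 1))) := by
      rw [hGx]; field_simp
    have hJ : ∫ t in Ioi (0 : ℝ), zetaIntegrand t x =
        1 / (2 * (x - 1)) - 2 ^ (-x) * ∑' n : ℕ, 1 / ((n : ℝ) + 1) ^ x := by
      apply mul_left_cancel₀ hG.ne'
      rw [hswap, div_one, Real.one_rpow, one_mul, hdiv, ← mul_sub]
    rw [hJ, mul_sub, ← mul_assoc, h2, one_mul, Real.rpow_sub_one two_ne_zero]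
    field_simp
    ring

/-! ### Effective convergence -/

theorem abs_zetaIntegrand_le {t x : ℝ} :
    |zetaIntegrand t x| ≤ Real.exp (-(Real.pi * t)) / (1 + t ^ 2) ^ (x / 2) := by
  have h1 := Real.exp_pos (Real.pi * t)
  have h2 : 0 < (1 + t ^ 2) ^ (x / 2) := Real.rpow_pos_of_pos (by positivity) _
  have h3 : 0 < (1 + t ^ 2) ^ (x / 2) * (Real.exp (Real.pi * t) + 1) := by positivity
  rw [zetaIntegrand, abs_div, abs_of_pos h3, Real.exp_neg, inv_eq_one_div, div_div,
    mul_comm (Real.exp _)]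
  gcongr
  · exact Real.abs_sin_le_one _
  · linarith

theorem continuous_zetaIntegrand : Continuous (Function.uncurry zetaIntegrand) := by
  unfold zetaIntegrand Function.uncurry
  refine Continuous.div (by fun_prop) ?_ fun p => ?_
  · refine Continuous.mul (Continuous.rpow (by fun_prop) (by fun_prop) fun p => Or.inl ?_)
      (by fun_prop)
    positivity
  · positivity

/-- On a time interval on which `1 + s ^ 2 ≥ b`, the algebraic factor of the integrand is replaced by
`b ^ (-x / 2)` and only the exponential one is integrated. -/
theorem abs_integral_zetaIntegrand_le {a b t x : ℝ} (hb : 0 < b) (hab : b ≤ 1 + a ^ 2) (ha : 0 ≤ a)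
    (hx : 0 ≤ x) (hat : a ≤ t) :
    |∫ s in a..t, zetaIntegrand s x| ≤ Real.exp (-(Real.pi * a)) / (Real.pi * b ^ (x / 2)) := by
  have hpi := Real.pi_pos
  have hbx : 0 < b ^ (x / 2) := Real.rpow_pos_of_pos hb _
  have hint : ∫ s in a..t, Real.exp (-(Real.pi * s)) / b ^ (x / 2) =
      (Real.exp (-(Real.pi * a)) - Real.exp (-(Real.pi * t))) / (Real.pi * b ^ (x / 2)) := by
    have hd : ∀ s ∈ uIcc a t, HasDerivAt
        (fun s => -(Real.exp (-(Real.pi * s)) / (Real.pi * b ^ (x / 2))))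
        (Real.exp (-(Real.pi * s)) / b ^ (x / 2)) s := fun s _ => by
      convert! ((((hasDerivAt_id s).const_mul Real.pi).neg.exp).div_const
        (Real.pi * b ^ (x / 2))).neg using 1
      have : (-fun y => Real.pi * y) s = -(Real.pi * s) := rfl
      simp only [id, this]
      field_simp
    rw [intervalIntegral.integral_eq_sub_of_hasDerivAt hd
      (Continuous.intervalIntegrable (by fun_prop) _ _)]
    ring
  calc |∫ s in a..t, zetaIntegrand s x|
      ≤ ∫ s in a..t, Real.exp (-(Real.pi * s)) / b ^ (x / 2) := by
        rw [← Real.norm_eq_abs]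
        refine intervalIntegral.norm_integral_le_of_norm_le hat ?_
          (Continuous.intervalIntegrable (by fun_prop) _ _)
        refine Eventually.of_forall fun s hs => abs_zetaIntegrand_le.trans ?_
        have : a ^ 2 ≤ s ^ 2 := by have := hs.1; gcongr
        gcongr
        linarith
    _ ≤ _ := by
        rw [hint]
        gcongr
        linarith [Real.exp_pos (-(Real.pi * t))]

variable {Ω : Set ℝ}

theorem pseudoNorm_nonneg (n : ℕ) (g : C(Ω, ℝ)) : 0 ≤ pseudoNorm n g :=
  Real.iSup_nonneg fun _ => abs_nonneg _

theorem summable_frechetDist (f g : C(Ω, ℝ)) :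
    Summable fun n : ℕ => (2 : ℝ)⁻¹ ^ (n + 1) * min (pseudoNorm (n + 1) (f - g)) 1 := by
  refine Summable.of_nonneg_of_le (fun n => ?_) (fun n => ?_)
    ((summable_nat_add_iff 1).2 (summable_geometric_of_lt_one (r := (2 : ℝ)⁻¹) (by norm_num)
      (by norm_num)))
  · have := pseudoNorm_nonneg (n + 1) (f - g)
    positivity
  · exact mul_le_of_le_one_right (by positivity) (min_le_right _ _)

/-- No point of `[2, ∞)` has absolute value at most `1`, so the first term of the metric is zero. -/
theorem frechetDist_le_half (f g : C(Ici (2 : ℝ), ℝ)) : frechetDist f g ≤ 1 / 2 := by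
  have h0 : pseudoNorm (0 + 1) (f - g) = 0 := by
    have : IsEmpty {x : Ici (2 : ℝ) // |(x : ℝ)| ≤ ((0 + 1 : ℕ) : ℝ)} :=
      ⟨fun x => by
        have h1 := (le_abs_self _).trans x.2
        have h2 : (2 : ℝ) ≤ x.1 := x.1.2
        norm_num at h1
        linarith⟩
    exact Real.iSup_of_isEmpty _
  have hg : HasSum (fun n : ℕ => (2 : ℝ)⁻¹ ^ (n + 1 + 1)) (1 / 2) := by
    have := (hasSum_geometric_of_lt_one (r := (2 : ℝ)⁻¹) (by norm_num) (by norm_num)).mul_left (1 / 4)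
    convert! this using 1
    · ext n; rw [pow_succ, pow_succ]; ring
    · norm_num
  rw [frechetDist, (summable_frechetDist f g).tsum_eq_zero_add, h0, min_eq_left zero_le_one,
    mul_zero, zero_add]
  refine (((summable_nat_add_iff 1).2 (summable_frechetDist f g)).tsum_le_tsum (fun n => ?_)
    hg.summable).trans_eq hg.tsum_eq
  exact mul_le_of_le_one_right (by positivity) (min_le_right _ _)

/-- Exponential growth in `|x|` at a rate `q < 2` is absorbed by the weights of the metric. -/
theorem frechetDist_le_of_forall {f g : C(Ω, ℝ)} {M q : ℝ} (hM : 0 ≤ M) (hq : 1 ≤ q) (hq2 : q < 2)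
    (h : ∀ x : Ω, |f x - g x| ≤ M * q ^ |(x : ℝ)|) :
    frechetDist f g ≤ M * (q / (2 - q)) := by
  have hq0 : 0 < q := by linarith
  have hg : HasSum (fun n : ℕ => M * (q / 2) ^ (n + 1)) (M * (q / (2 - q))) := by
    have := (hasSum_geometric_of_lt_one (r := q / 2) (by positivity) (by linarith)).mul_left
      (M * (q / 2))
    convert! this using 1
    · ext n; rw [pow_succ]; ring
    · have : 2 - q ≠ 0 := by linarith
      have : 1 - q / 2 ≠ 0 := by linarith
      field_simp
  refine ((summable_frechetDist f g).tsum_le_tsum (fun n => ?_) hg.summable).trans_eq hg.tsum_eq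
  have hp : pseudoNorm (n + 1) (f - g) ≤ M * q ^ (n + 1) := by
    refine Real.iSup_le (fun x => ?_) (by positivity)
    refine (h x.1).trans ?_
    rw [← Real.rpow_natCast]
    gcongr
    exact x.2
  calc (2 : ℝ)⁻¹ ^ (n + 1) * min (pseudoNorm (n + 1) (f - g)) 1
      ≤ (2 : ℝ)⁻¹ ^ (n + 1) * (M * q ^ (n + 1)) := by
        gcongr
        exact (min_le_left _ _).trans hp
    _ = M * (q / 2) ^ (n + 1) := by rw [div_pow, inv_pow]; ring

/-- The partial integrals of the zeta integrand converge with the modulus `id`, and so with every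
larger one. -/
theorem isConvergentCauchy_of_zetaIntegrand {c : Ici (2 : ℝ) → ℝ} {u : C1Stream C(Ici (2 : ℝ), ℝ)}
    (hu : ∀ t x, u t x = c x - 2 ^ (x : ℝ) * ∫ s in (0 : ℝ)..t, zetaIntegrand s x)
    {T : C1Stream ℝ} (hT : ∀ τ : ℝ≥0, (τ : ℝ) ≤ T τ) : IsConvergentCauchy T u := by
  have hpi := Real.pi_gt_three
  have hint : ∀ (x a b : ℝ), IntervalIntegrable (fun s => zetaIntegrand s x) volume a b :=
    fun x a b => (continuous_zetaIntegrand.comp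
      (Continuous.prodMk continuous_id continuous_const)).intervalIntegrable a b
  have hdiff : ∀ (s t : ℝ≥0) (x : Ici (2 : ℝ)),
      |u s x - u t x| = 2 ^ (x : ℝ) * |∫ r in (t : ℝ)..s, zetaIntegrand r x| := fun s t x => by
    have h : u s x - u t x = 2 ^ (x : ℝ) * -∫ r in (t : ℝ)..s, zetaIntegrand r x := by
      rw [hu, hu, ← intervalIntegral.integral_interval_sub_left (hint x 0 s) (hint x 0 t)]
      ring
    rw [h, abs_mul, abs_neg, abs_of_pos (Real.rpow_pos_of_pos two_pos _)]
  intro τ s t hs ht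
  replace hs := (hT τ).trans hs
  replace ht := (hT τ).trans ht
  -- for `τ < 1` the trivial bound `1 / 2` suffices
  rcases lt_or_ge (τ : ℝ) 1 with hτ | hτ
  · refine (frechetDist_le_half _ _).trans_lt ?_
    rw [one_div, ← Real.rpow_neg_one]
    exact Real.rpow_lt_rpow_of_exponent_lt one_lt_two (by linarith)
  -- from time `1` on the factor `(1 + s ^ 2) ^ (-x / 2)` is at most `2 ^ (-x / 2)`, which leaves
  -- `2 ^ (x / 2) ≤ (3 / 2) ^ x` of the factor `2 ^ x`
  have hle : ∀ a b : ℝ≥0, (τ : ℝ) ≤ a → a ≤ b → ∀ x : Ici (2 : ℝ),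
      |u b x - u a x| ≤ Real.exp (-(Real.pi * τ)) / Real.pi * (3 / 2) ^ |(x : ℝ)| := by
    intro a b ha hab x
    have hx : (2 : ℝ) ≤ x := x.2
    have hab' : (a : ℝ) ≤ b := hab
    rw [hdiff, abs_of_nonneg (by linarith : (0 : ℝ) ≤ x)]
    have h2 : (2 : ℝ) ^ (x : ℝ) = 2 ^ ((x : ℝ) / 2) * 2 ^ ((x : ℝ) / 2) := by
      rw [← Real.rpow_add two_pos, add_halves]
    have h3 : (2 : ℝ) ^ ((x : ℝ) / 2) ≤ (3 / 2) ^ (x : ℝ) := by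
      have : ((3 : ℝ) / 2) ^ (x : ℝ) = ((3 / 2) ^ (2 : ℝ)) ^ ((x : ℝ) / 2) := by
        rw [← Real.rpow_mul (by norm_num)]; ring_nf
      rw [this]
      refine Real.rpow_le_rpow two_pos.le (by norm_num) (by linarith)
    have h4 : 0 < (2 : ℝ) ^ ((x : ℝ) / 2) := Real.rpow_pos_of_pos two_pos _
    calc 2 ^ (x : ℝ) * |∫ r in (a : ℝ)..b, zetaIntegrand r x|
        ≤ 2 ^ (x : ℝ) * (Real.exp (-(Real.pi * a)) / (Real.pi * 2 ^ ((x : ℝ) / 2))) := by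
          gcongr
          exact abs_integral_zetaIntegrand_le two_pos (by nlinarith) a.2 (by linarith) hab'
      _ = Real.exp (-(Real.pi * a)) / Real.pi * 2 ^ ((x : ℝ) / 2) := by
          rw [h2]; field_simp
      _ ≤ _ := by gcongr
  have hbound : ∀ x : Ici (2 : ℝ),
      |u s x - u t x| ≤ Real.exp (-(Real.pi * τ)) / Real.pi * (3 / 2) ^ |(x : ℝ)| := fun x => by
    rcases le_total s t with hst | hst
    · rw [abs_sub_comm]; exact hle s t hs hst x
    · exact hle t s ht hst x
  refine (frechetDist_le_of_forall (by positivity) (by norm_num) (by norm_num) hbound).trans_lt ?_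
  have hexp : Real.exp (-(Real.pi * τ)) ≤ 2 ^ (-(τ : ℝ)) := by
    rw [Real.rpow_def_of_pos two_pos]
    have := Real.log_two_lt_d9
    gcongr
    nlinarith
  refine lt_of_lt_of_le ?_ hexp
  have he := Real.exp_pos (-(Real.pi * τ))
  rw [div_mul_eq_mul_div, div_lt_iff₀ (by positivity)]
  norm_num
  exact mul_lt_mul_of_pos_left hpi he

theorem tendsto_of_zetaIntegrand {c : Ici (2 : ℝ) → ℝ} {u : ℝ≥0 → C(Ici (2 : ℝ), ℝ)}
    {z : C(Ici (2 : ℝ), ℝ)}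
    (hu : ∀ t x, u t x = c x - 2 ^ (x : ℝ) * ∫ s in (0 : ℝ)..t, zetaIntegrand s x)
    (hz : ∀ x : Ici (2 : ℝ), IntegrableOn (fun s => zetaIntegrand s x) (Ioi 0) ∧
      z x = c x - 2 ^ (x : ℝ) * ∫ s in Ioi (0 : ℝ), zetaIntegrand s x) :
    Tendsto u atTop (𝓝 z) := by
  have hpi := Real.pi_pos
  have htail : ∀ (t : ℝ≥0) (x : Ici (2 : ℝ)),
      |u t x - z x| ≤ 2 ^ (x : ℝ) * (Real.exp (-(Real.pi * t)) / Real.pi) := fun t x => by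
    have hx : (2 : ℝ) ≤ x := x.2
    have hlim := intervalIntegral_tendsto_integral_Ioi (t : ℝ)
      ((hz x).1.mono_set (Ioi_subset_Ioi t.coe_nonneg)) tendsto_id
    have hsplit : (∫ s in Ioi (0 : ℝ), zetaIntegrand s x) =
        (∫ s in (0 : ℝ)..t, zetaIntegrand s x) + ∫ s in Ioi (t : ℝ), zetaIntegrand s x := by
      rw [intervalIntegral.integral_of_le t.coe_nonneg, ← setIntegral_union Ioc_disjoint_Ioi_same
        measurableSet_Ioi ((hz x).1.mono_set Ioc_subset_Ioi_self)
        ((hz x).1.mono_set (Ioi_subset_Ioi t.coe_nonneg)), Ioc_union_Ioi_eq_Ioi t.coe_nonneg]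
    have h : u t x - z x = 2 ^ (x : ℝ) * ∫ s in Ioi (t : ℝ), zetaIntegrand s x := by
      rw [hu, (hz x).2, hsplit]; ring
    rw [h, abs_mul, abs_of_pos (Real.rpow_pos_of_pos two_pos _)]
    gcongr
    refine le_of_tendsto hlim.abs ?_
    filter_upwards [eventually_ge_atTop (t : ℝ)] with r hr
    have := abs_integral_zetaIntegrand_le (b := 1) (x := x) one_pos (by nlinarith [t.2]) t.2
      (by linarith) hr
    simpa using this
  rw [ContinuousMap.tendsto_iff_forall_isCompact_tendstoUniformlyOn]
  intro K hK
  have hb : BddAbove ((fun x : Ici (2 : ℝ) => (2 : ℝ) ^ (x : ℝ)) '' K) :=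
    hK.bddAbove_image (Continuous.continuousOn
      (Continuous.rpow continuous_const continuous_subtype_val fun _ => Or.inl two_ne_zero))
  obtain ⟨B, hB⟩ := hb
  have hlim : Tendsto (fun t : ℝ≥0 => B * (Real.exp (-(Real.pi * t)) / Real.pi)) atTop (𝓝 0) := by
    have h1 : Tendsto (fun t : ℝ≥0 => Real.pi * (t : ℝ)) atTop atTop :=
      (NNReal.tendsto_coe_atTop.2 tendsto_id).const_mul_atTop hpi
    simpa using ((Real.tendsto_exp_neg_atTop_nhds_zero.comp h1).div_const Real.pi).const_mul B
  rw [Metric.tendstoUniformlyOn_iff]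
  intro ε hε
  filter_upwards [hlim.eventually (gt_mem_nhds hε)] with t ht x hx
  rw [dist_comm, Real.dist_eq]
  refine ((htail t x).trans ?_).trans_lt ht
  gcongr
  exact hB ⟨x, hx, rfl⟩

/-! ### Calculus of streams -/

theorem HasTimeDeriv.unique {E : Type} [AddCommGroup E] [Module ℝ E] [TopologicalSpace E]
    [T2Space E] {u d d' : ℝ≥0 → E} (h : HasTimeDeriv u d) (h' : HasTimeDeriv u d') : d = d' :=
  funext fun t => tendsto_nhds_unique (h t) (h' t)

theorem C1Stream.hasTimeDeriv_deriv {E : Type} [AddCommGroup E] [Module ℝ E] [TopologicalSpace E]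
    (u : C1Stream E) : HasTimeDeriv u u.deriv :=
  u.exists_deriv.choose_spec

section Streams

variable {Ω : Set ℝ}

theorem C1Stream.deriv_lift_time (t : ℝ≥0) (x : Ω) :
    (C1Stream.lift Ω C1Stream.time).deriv t x = 1 := by
  have h := (C1Stream.lift Ω C1Stream.time).hasTimeDeriv_deriv
  have h' : HasTimeDeriv (C1Stream.lift Ω C1Stream.time) fun _ => (1 : C(Ω, ℝ)) := fun t => by
    refine tendsto_const_nhds.congr' ?_
    filter_upwards [self_mem_nhdsWithin] with s hs
    have hst : (s : ℝ) - t ≠ 0 := sub_ne_zero.mpr fun h => hs (NNReal.coe_injective h)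
    ext x
    change (1 : ℝ) = ((s : ℝ) - t)⁻¹ * (1 * (s : ℝ) - 1 * (t : ℝ))
    field_simp
  rw [h.unique h']
  rfl

/-- For the integration variable `v = t` the factor `v' = 1` disappears. -/
theorem isIntegralFn_lift_time_iff {c : C(Ω, ℝ)} {u w : C1Stream C(Ω, ℝ)} :
    IsIntegralFn c u (C1Stream.lift Ω C1Stream.time) w ↔
      ∀ (t : ℝ≥0) (x : Ω), w t x = c x + ∫ s in (0 : ℝ)..t, u s.toNNReal x := by
  simp only [IsIntegralFn, C1Stream.deriv_lift_time, mul_one]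

/-- The pointwise sum of two streams. -/
def C1Stream.add (u v : C1Stream C(Ω, ℝ)) : C1Stream C(Ω, ℝ) where
  toMap := u.toMap + v.toMap
  exists_deriv := by
    refine ⟨u.deriv + v.deriv, fun t => ?_⟩
    refine ((u.hasTimeDeriv_deriv t).add (v.hasTimeDeriv_deriv t)).congr fun s => ?_
    rw [← smul_add, ContinuousMap.add_apply, ContinuousMap.add_apply, add_sub_add_comm]

/-- A function of time and a point of `Ω` that has a jointly continuous time derivative, as a `C¹`
stream: by the mean value inequality the difference quotients converge uniformly on compacta. -/
def C1Stream.ofHasDerivAt (f f' : ℝ → Ω → ℝ) (hf : Continuous (Function.uncurry f))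
    (hf' : Continuous (Function.uncurry f')) (hd : ∀ t x, HasDerivAt (fun t => f t x) (f' t x) t) :
    C1Stream C(Ω, ℝ) where
  toMap := (ContinuousMap.curry ⟨Function.uncurry f, hf⟩).comp ⟨NNReal.toReal, by fun_prop⟩
  exists_deriv := by
    let F' : C(ℝ, C(Ω, ℝ)) := ContinuousMap.curry ⟨Function.uncurry f', hf'⟩
    refine ⟨F'.comp ⟨NNReal.toReal, by fun_prop⟩, fun t => ?_⟩
    rw [ContinuousMap.tendsto_iff_forall_isCompact_tendstoUniformlyOn]
    intro K hK
    rw [Metric.tendstoUniformlyOn_iff]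
    intro ε hε
    have hF' := F'.continuous.tendsto (t : ℝ)
    rw [ContinuousMap.tendsto_iff_forall_isCompact_tendstoUniformlyOn] at hF'
    obtain ⟨δ, hδ, hball⟩ := Metric.eventually_nhds_iff.1
      (Metric.tendstoUniformlyOn_iff.1 (hF' K hK) (ε / 2) (half_pos hε))
    have hnear : ∀ᶠ s : ℝ≥0 in 𝓝[≠] t, dist (s : ℝ) t < δ :=
      ((NNReal.continuous_coe.tendsto t).mono_left nhdsWithin_le_nhds).eventually
        (Metric.ball_mem_nhds _ hδ)
    filter_upwards [hnear, self_mem_nhdsWithin] with s hs hne x hx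
    have hst : (s : ℝ) - t ≠ 0 := sub_ne_zero.mpr fun h => hne (NNReal.coe_injective h)
    have hmv := (convex_ball (t : ℝ) δ).norm_image_sub_le_of_norm_hasDerivWithin_le
      (f := fun r => f r x - r * f' t x) (f' := fun r => f' r x - 1 * f' t x) (C := ε / 2)
      (fun r _ => ((hd r x).sub ((hasDerivAt_id r).mul_const (f' t x))).hasDerivWithinAt)
      (fun r hr => by
        have := (hball hr x hx).le
        rw [dist_comm, Real.dist_eq] at this
        simpa using! this)
      (Metric.mem_ball_self hδ) (Metric.mem_ball.2 hs)
    have heq : ((s : ℝ) - t)⁻¹ * (f s x - f t x) - f' t x =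
        ((s : ℝ) - t)⁻¹ * ((f s x - s * f' t x) - (f t x - t * f' t x)) := by
      field_simp
      ring
    rw [dist_comm, Real.dist_eq]
    change |((s : ℝ) - t)⁻¹ * (f s x - f t x) - f' t x| < ε
    rw [heq, abs_mul, abs_inv]
    have hpos : 0 < |(s : ℝ) - t| := abs_pos.2 hst
    rw [inv_mul_lt_iff₀ hpos]
    refine hmv.trans_lt ?_
    rw [Real.norm_eq_abs, mul_comm]
    gcongr
    linarith

variable [LocallyCompactSpace Ω]

/-- The pointwise product of two streams; its derivative is given by the Leibniz rule. -/
def C1Stream.mul (u v : C1Stream C(Ω, ℝ)) : C1Stream C(Ω, ℝ) where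
  toMap := u.toMap * v.toMap
  exists_deriv := by
    refine ⟨u.deriv * v.toMap + u.toMap * v.deriv, fun t => ?_⟩
    have hv : Tendsto (fun s => v s) (𝓝[≠] t) (𝓝 (v t)) :=
      (v.toMap.continuous.tendsto t).mono_left nhdsWithin_le_nhds
    refine (((u.hasTimeDeriv_deriv t).mul hv).add
      ((v.hasTimeDeriv_deriv t).const_mul (u t))).congr fun s => ?_
    ext x
    simp only [ContinuousMap.add_apply, ContinuousMap.mul_apply, ContinuousMap.smul_apply,
      ContinuousMap.sub_apply, smul_eq_mul]
    ring

/-- The stream `c(x) + ∫₀ᵗ u(s, x) ds`. -/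
def C1Stream.primitive (c : C(Ω, ℝ)) (u : C(ℝ≥0, C(Ω, ℝ))) : C1Stream C(Ω, ℝ) :=
  have hu : Continuous fun p : Ω × ℝ => u p.2.toNNReal p.1 := by fun_prop
  .ofHasDerivAt (fun t x => c x + ∫ s in (0 : ℝ)..t, u s.toNNReal x) (fun t x => u t.toNNReal x)
    ((c.continuous.comp continuous_snd).add
      (intervalIntegral.continuous_parametric_intervalIntegral_of_continuous
        (f := fun (p : ℝ × Ω) s => u s.toNNReal p.2) (by fun_prop) continuous_fst))
    (by fun_prop) fun t x =>
      have hx : Continuous fun s : ℝ => u s.toNNReal x := by fun_prop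
      (intervalIntegral.integral_hasDerivAt_right (hx.intervalIntegrable _ _)
        hx.stronglyMeasurable.stronglyMeasurableAtFilter hx.continuousAt).const_add _

theorem C1Stream.primitive_apply (c : C(Ω, ℝ)) (u : C(ℝ≥0, C(Ω, ℝ))) (t : ℝ≥0) (x : Ω) :
    C1Stream.primitive c u t x = c x + ∫ s in (0 : ℝ)..t, u s.toNNReal x := rfl

end Streams

/-! ### Integral equations -/

/-- A function which vanishes at `0` and satisfies a homogeneous linear equation `Y' = g Y` on
`[0, ∞)` is zero there. -/
theorem eq_zero_of_hasDerivAt_mul {Y Y' g : ℝ → ℝ} (hY : ∀ t, HasDerivAt Y (Y' t) t)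
    (h0 : Y 0 = 0) (hg : Continuous g) (h : ∀ t, 0 ≤ t → Y' t = g t * Y t) {t : ℝ} (ht : 0 ≤ t) :
    Y t = 0 := by
  set G : ℝ → ℝ := fun t => ∫ s in (0 : ℝ)..t, g s
  have hG : ∀ t, HasDerivAt G (g t) t := fun t =>
    intervalIntegral.integral_hasDerivAt_right (hg.intervalIntegrable _ _)
      hg.stronglyMeasurable.stronglyMeasurableAtFilter hg.continuousAt
  have hZ : ∀ s, HasDerivAt (fun s => Y s * Real.exp (-G s))
      (Y' s * Real.exp (-G s) + Y s * (Real.exp (-G s) * -g s)) s := fun s =>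
    (hY s).mul (hG s).neg.exp
  have hconst := constant_of_has_deriv_right_zero (a := 0) (b := t)
    (fun s _ => (hZ s).continuousAt.continuousWithinAt) (fun s hs => by
      have h1 := (hZ s).hasDerivWithinAt (s := Ici s)
      rw [h s hs.1] at h1
      convert! h1 using 1
      ring) t ⟨ht, le_rfl⟩
  simp only [h0, zero_mul] at hconst
  exact (mul_eq_zero.1 hconst).resolve_right (Real.exp_ne_zero _)

/-- The right-hand side of an integral equation, as a function on all of `ℝ`. -/
theorem exists_hasDerivAt_of_integral_eq {c : ℝ} {w : ℝ≥0 → ℝ} {u : ℝ≥0 → ℝ} (hu : Continuous u)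
    (h : ∀ t : ℝ≥0, w t = c + ∫ s in (0 : ℝ)..t, u s.toNNReal) :
    ∃ W : ℝ → ℝ, (∀ t, HasDerivAt W (u t.toNNReal) t) ∧ W 0 = c ∧
      ∀ t : ℝ≥0, w t = W t := by
  have hc : Continuous fun s : ℝ => u s.toNNReal := hu.comp continuous_real_toNNReal
  refine ⟨fun t => c + ∫ s in (0 : ℝ)..t, u s.toNNReal, fun t => ?_, by simp, h⟩
  exact (intervalIntegral.integral_hasDerivAt_right (hc.intervalIntegrable _ _)
      hc.stronglyMeasurable.stronglyMeasurableAtFilter hc.continuousAt).const_add c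

theorem eq_add_integral_of_hasDerivAt {f f' : ℝ → ℝ} {u : ℝ≥0 → ℝ}
    (hd : ∀ t, HasDerivAt f (f' t) t) (hf' : Continuous f') (hu : ∀ t : ℝ≥0, u t = f' t) (t : ℝ≥0) :
    f t = f 0 + ∫ s in (0 : ℝ)..t, u s.toNNReal := by
  have h : ∫ s in (0 : ℝ)..t, u s.toNNReal = ∫ s in (0 : ℝ)..t, f' s := by
    refine intervalIntegral.integral_congr fun s hs => ?_
    rw [uIcc_of_le t.coe_nonneg] at hs
    simp only [hu, Real.coe_toNNReal s hs.1]
  rw [h, intervalIntegral.integral_eq_sub_of_hasDerivAt (fun s _ => hd s)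
    (hf'.intervalIntegrable _ _)]
  ring

/-! ### The functions carried by the network -/

theorem hasDerivAt_one_div_one_add_sq (t : ℝ) :
    HasDerivAt (fun t : ℝ => 1 / (1 + t ^ 2)) (-2 * t * (1 / (1 + t ^ 2)) ^ 2) t := by
  have h : (1 + t ^ 2) ≠ 0 := by positivity
  convert! (hasDerivAt_const t (1 : ℝ)).div ((hasDerivAt_pow 2 t).const_add 1) h using 1
  field_simp
  ring

theorem hasDerivAt_one_div_exp_add_one (t : ℝ) :
    HasDerivAt (fun t : ℝ => 1 / (Real.exp (Real.pi * t) + 1))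
      (Real.pi * (1 / (Real.exp (Real.pi * t) + 1) * (1 / (Real.exp (Real.pi * t) + 1) - 1))) t := by
  have h : Real.exp (Real.pi * t) + 1 ≠ 0 := by positivity
  convert! (hasDerivAt_const t (1 : ℝ)).div
    ((((hasDerivAt_id t).const_mul Real.pi).exp).add_const 1) h using 1
  simp only [id]
  field_simp
  ring

/-- The imaginary part of `(1 - i t) ^ (-x)`. -/
def sinPart (t x : ℝ) : ℝ := Real.sin (x * Real.arctan t) * (1 + t ^ 2) ^ (-(x / 2))

/-- The real part of `(1 - i t) ^ (-x)`. -/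
def cosPart (t x : ℝ) : ℝ := Real.cos (x * Real.arctan t) * (1 + t ^ 2) ^ (-(x / 2))

theorem hasDerivAt_one_add_sq_rpow (t x : ℝ) :
    HasDerivAt (fun t : ℝ => (1 + t ^ 2) ^ (-(x / 2)))
      (-(x * (1 / (1 + t ^ 2)) * t * (1 + t ^ 2) ^ (-(x / 2)))) t := by
  have h : (1 + t ^ 2) ≠ 0 := by positivity
  convert! ((hasDerivAt_pow 2 t).const_add 1).rpow_const (p := -(x / 2)) (Or.inl h) using 1
  rw [Real.rpow_sub_one h]
  field_simp
  ring

theorem hasDerivAt_sinPart (t x : ℝ) :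
    HasDerivAt (fun t => sinPart t x)
      (x * (1 / (1 + t ^ 2)) * (cosPart t x - t * sinPart t x)) t := by
  convert! (((Real.hasDerivAt_arctan t).const_mul x).sin).mul (hasDerivAt_one_add_sq_rpow t x)
    using 1
  simp only [sinPart, cosPart]
  ring

theorem hasDerivAt_cosPart (t x : ℝ) :
    HasDerivAt (fun t => cosPart t x)
      (x * (1 / (1 + t ^ 2)) * (-(t * cosPart t x) - sinPart t x)) t := by
  convert! (((Real.hasDerivAt_arctan t).const_mul x).cos).mul (hasDerivAt_one_add_sq_rpow t x)
    using 1
  simp only [sinPart, cosPart]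
  ring

theorem sinPart_mul_eq_zetaIntegrand (t x : ℝ) :
    sinPart t x * (1 / (Real.exp (Real.pi * t) + 1)) = zetaIntegrand t x := by
  have h : (0 : ℝ) < (1 + t ^ 2) ^ (x / 2) := Real.rpow_pos_of_pos (by positivity) _
  rw [sinPart, zetaIntegrand, Real.rpow_neg (by positivity)]
  field_simp

/-- The difference `Y` of two solutions `W₁`, `W₂` of `W' = -2 t W ^ 2` satisfies
`Y' = -2 t (W₁ + W₂) Y`. -/
theorem eq_one_div_one_add_sq {w : ℝ≥0 → ℝ} (hw : Continuous w)
    (h : ∀ t : ℝ≥0, w t = 1 + ∫ s in (0 : ℝ)..t, -2 * (s.toNNReal : ℝ) * w s.toNNReal ^ 2)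
    (t : ℝ≥0) : w t = 1 / (1 + (t : ℝ) ^ 2) := by
  obtain ⟨W, hW, hW0, hwW⟩ := exists_hasDerivAt_of_integral_eq
    (u := fun s => -2 * (s : ℝ) * w s ^ 2) (by fun_prop) h
  have hWc : Continuous W := continuous_iff_continuousAt.2 fun t => (hW t).continuousAt
  have hg : Continuous fun t : ℝ => -2 * t * (W t + 1 / (1 + t ^ 2)) := by
    refine Continuous.mul (by fun_prop) (hWc.add (continuous_const.div (by fun_prop) fun t => ?_))
    positivity
  have := eq_zero_of_hasDerivAt_mul (fun t => (hW t).sub (hasDerivAt_one_div_one_add_sq t))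
    (by simp [hW0]) hg (fun t ht => by
      rw [hwW, Real.coe_toNNReal t ht, Pi.sub_apply]; ring) t.coe_nonneg
  rw [hwW]
  exact sub_eq_zero.1 this

/-- The difference `Y` of two solutions `W₁`, `W₂` of `W' = π W (W - 1)` satisfies
`Y' = π (W₁ + W₂ - 1) Y`. -/
theorem eq_one_div_exp_add_one {w : ℝ≥0 → ℝ} (hw : Continuous w)
    (h : ∀ t : ℝ≥0, w t = 1 / 2 +
      ∫ s in (0 : ℝ)..t, Real.pi * (w s.toNNReal * (w s.toNNReal - 1)))
    (t : ℝ≥0) : w t = 1 / (Real.exp (Real.pi * t) + 1) := by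
  obtain ⟨W, hW, hW0, hwW⟩ := exists_hasDerivAt_of_integral_eq
    (u := fun s => Real.pi * (w s * (w s - 1))) (by fun_prop) h
  have hWc : Continuous W := continuous_iff_continuousAt.2 fun t => (hW t).continuousAt
  have hg : Continuous fun t : ℝ => Real.pi * (W t + 1 / (Real.exp (Real.pi * t) + 1) - 1) := by
    refine continuous_const.mul ((hWc.add (continuous_const.div (by fun_prop) fun t => ?_)).sub
      continuous_const)
    positivity
  have := eq_zero_of_hasDerivAt_mul (fun t => (hW t).sub (hasDerivAt_one_div_exp_add_one t))
    (by rw [Pi.sub_apply, hW0]; norm_num) hg (fun t ht => by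
      rw [hwW, Real.coe_toNNReal t ht, Pi.sub_apply]; ring) t.coe_nonneg
  rw [hwW]
  exact sub_eq_zero.1 this

/-- The squared distance `Y` of two solutions of the linear system
`a' = x (b - t a) / (1 + t ^ 2)`, `b' = x (-t b - a) / (1 + t ^ 2)` satisfies
`Y' = -2 x t / (1 + t ^ 2) Y`. -/
theorem eq_sinPart_and_eq_cosPart {x : ℝ} {a b : ℝ≥0 → ℝ} (ha : Continuous a) (hb : Continuous b)
    (h₁ : ∀ t : ℝ≥0, a t = 0 + ∫ s in (0 : ℝ)..t, x * (1 / (1 + (s.toNNReal : ℝ) ^ 2)) *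
      (b s.toNNReal - s.toNNReal * a s.toNNReal))
    (h₂ : ∀ t : ℝ≥0, b t = 1 + ∫ s in (0 : ℝ)..t, x * (1 / (1 + (s.toNNReal : ℝ) ^ 2)) *
      (-(s.toNNReal * b s.toNNReal) - a s.toNNReal)) (t : ℝ≥0) :
    a t = sinPart t x ∧ b t = cosPart t x := by
  have hr : Continuous fun s : ℝ => 1 / (1 + s ^ 2) :=
    continuous_const.div (by fun_prop) fun s => by positivity
  have hr' : Continuous fun s : ℝ≥0 => 1 / (1 + (s : ℝ) ^ 2) := hr.comp NNReal.continuous_coe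
  obtain ⟨A, hA, hA0, haA⟩ := exists_hasDerivAt_of_integral_eq
    (u := fun s => x * (1 / (1 + (s : ℝ) ^ 2)) * (b s - s * a s)) (by fun_prop) h₁
  obtain ⟨B, hB, hB0, hbB⟩ := exists_hasDerivAt_of_integral_eq
    (u := fun s => x * (1 / (1 + (s : ℝ) ^ 2)) * (-(s * b s) - a s)) (by fun_prop) h₂
  have hY := eq_zero_of_hasDerivAt_mul
    (g := fun s => -2 * x * s * (1 / (1 + s ^ 2)))
    (fun s => (((hA s).sub (hasDerivAt_sinPart s x)).pow 2).add
      (((hB s).sub (hasDerivAt_cosPart s x)).pow 2))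
    (by simp [hA0, hB0, sinPart, cosPart]) (by fun_prop) (fun s hs => by
      simp only [haA, hbB, Real.coe_toNNReal s hs, Pi.sub_apply, Pi.add_apply, Pi.pow_apply]
      push_cast
      ring) t.coe_nonneg
  have hY' : (A t - sinPart t x) ^ 2 + (B t - cosPart t x) ^ 2 = 0 := hY
  rw [haA, hbB]
  constructor <;> nlinarith [sq_nonneg (A t - sinPart t x), sq_nonneg (B t - cosPart t x)]

/-! ### The network and its solution -/

/-- The output types of the modules of `zetaNetwork`. -/
def zetaTy : Fin 31 → Channel :=
  ![.realScalar, .realScalar, .realScalar, .realStream, .realStream,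
    .fnStream, .fnStream, .fnStream, .fnStream, .fnStream, .fnStream, .fnStream,
    .fnStream, .fnStream, .fnStream, .fnStream, .fnStream, .fnStream, .fnStream,
    .fnStream, .fnStream, .fnStream, .fnStream, .fnStream, .fnStream, .fnStream,
    .fnStream, .fnStream, .fnScalar, .fnStream, .fnScalar]

/-- The typing of an empty family of proper inputs. -/
abbrev noInputs : Fin 0 → Channel := Fin.elim0

section Network

variable {Ω : Set ℝ}

variable (Ω) in
/-- The function `x ↦ x`. -/
def coordinate : C(Ω, ℝ) := ⟨Subtype.val, continuous_subtype_val⟩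

/-- The modules of `zetaNetwork`. Modules `0` to `5` are constants, and module `6` outputs `-t`.
The feedback loops are
* `7` to `10`: the integrator `10` solves `r' = -2 t r ^ 2`, `r 0 = 1`, so `r = 1 / (1 + t ^ 2)`;
* `11` to `14`: the integrator `14` solves `e' = π e (e - 1)`, `e 0 = 1 / 2`, so
  `e = 1 / (exp (π t) + 1)`;
* `15` to `24`: the integrators `22` and `23` solve `a' = x r (b - t a)`, `b' = x r (-t b - a)`,
  `a 0 = 0`, `b 0 = 1`, so `b + i a = (1 - i t) ^ (-x)`.
Module `25` outputs `a e`, the integrand of the zeta function, and modules `26` to `29` compute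
`c + ∫ g a e`. Module `30` is the parameter `last`. -/
def zetaNode (g c : C(Ω, ℝ)) (last : Node Ω zetaTy noInputs .fnScalar) :
    ∀ j : Fin 31, Node Ω zetaTy noInputs (zetaTy j)
  | 0 => .constRealScalar 0
  | 1 => .constRealScalar (1 / 2)
  | 2 => .constRealScalar 1
  | 3 => .constReal (-1)
  | 4 => .constReal Real.pi
  | 5 => .constFn (coordinate Ω)
  | 6 => .mulFn (.liftStream (.node 3)) (.liftStream .time)
  | 7 => .addFn (.node 6) (.node 6)
  | 8 => .mulFn (.node 10) (.node 10)
  | 9 => .mulFn (.node 7) (.node 8)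
  | 10 => .integralFn (.liftScalar (.node 2)) (.node 9) (.liftStream .time)
  | 11 => .addFn (.node 14) (.liftStream (.node 3))
  | 12 => .mulFn (.node 14) (.node 11)
  | 13 => .mulFn (.liftStream (.node 4)) (.node 12)
  | 14 => .integralFn (.liftScalar (.node 1)) (.node 13) (.liftStream .time)
  | 15 => .mulFn (.node 5) (.node 10)
  | 16 => .mulFn (.node 6) (.node 22)
  | 17 => .mulFn (.node 6) (.node 23)
  | 18 => .mulFn (.liftStream (.node 3)) (.node 22)
  | 19 => .addFn (.node 23) (.node 16)
  | 20 => .addFn (.node 17) (.node 18)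
  | 21 => .mulFn (.node 15) (.node 19)
  | 22 => .integralFn (.liftScalar (.node 0)) (.node 21) (.liftStream .time)
  | 23 => .integralFn (.liftScalar (.node 2)) (.node 24) (.liftStream .time)
  | 24 => .mulFn (.node 15) (.node 20)
  | 25 => .mulFn (.node 22) (.node 14)
  | 26 => .constFn g
  | 27 => .mulFn (.node 26) (.node 25)
  | 28 => .constFnScalar c
  | 29 => .integralFn (.node 28) (.node 27) (.liftStream .time)
  | 30 => last
  | ⟨n + 31, h⟩ => absurd h (by omega)

/-- A network without proper inputs whose module `25` outputs the integrand `ζ₂` of the zeta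
function and whose module `29` outputs `c + ∫ g ζ₂`. Its last module is left open, so that the network can be
used with and without a limit module. -/
def zetaNetwork (g c : C(Ω, ℝ)) (last : Node Ω zetaTy noInputs .fnScalar) : Network Ω where
  numModules := 31
  numInputs := 0
  ty := zetaTy
  inTy := noInputs
  node := zetaNode g c last

theorem continuous_one_div_one_add_sq : Continuous fun t : ℝ => 1 / (1 + t ^ 2) :=
  continuous_const.div (by fun_prop) fun t => by positivity

theorem continuous_one_div_exp_add_one :
    Continuous fun t : ℝ => 1 / (Real.exp (Real.pi * t) + 1) :=
  continuous_const.div (by fun_prop) fun t => by positivity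

variable (Ω) in
/-- The stream `1 / (1 + t ^ 2)`. -/
def lorentzStream : C1Stream C(Ω, ℝ) :=
  have h : Continuous fun p : ℝ × Ω => 1 / (1 + p.1 ^ 2) :=
    continuous_one_div_one_add_sq.comp continuous_fst
  .ofHasDerivAt (fun t _ => 1 / (1 + t ^ 2)) (fun t _ => -2 * t * (1 / (1 + t ^ 2)) ^ 2)
    h (Continuous.mul (by fun_prop) (h.pow 2))
    fun t _ => hasDerivAt_one_div_one_add_sq t

variable (Ω) in
/-- The stream `1 / (exp (π t) + 1)`. -/
def logisticStream : C1Stream C(Ω, ℝ) :=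
  have h : Continuous fun p : ℝ × Ω => 1 / (Real.exp (Real.pi * p.1) + 1) :=
    continuous_one_div_exp_add_one.comp continuous_fst
  .ofHasDerivAt (fun t _ => 1 / (Real.exp (Real.pi * t) + 1))
    (fun t _ => Real.pi * (1 / (Real.exp (Real.pi * t) + 1) *
      (1 / (Real.exp (Real.pi * t) + 1) - 1)))
    h (continuous_const.mul (h.mul (h.sub continuous_const)))
    fun t _ => hasDerivAt_one_div_exp_add_one t

theorem continuous_sinPart {X : Type*} [TopologicalSpace X] {f g : X → ℝ} (hf : Continuous f)
    (hg : Continuous g) : Continuous fun p => sinPart (f p) (g p) :=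
  (by fun_prop : Continuous fun p => Real.sin (g p * Real.arctan (f p))).mul
    (Continuous.rpow (by fun_prop) (by fun_prop) fun p => Or.inl (by positivity))

theorem continuous_cosPart {X : Type*} [TopologicalSpace X] {f g : X → ℝ} (hf : Continuous f)
    (hg : Continuous g) : Continuous fun p => cosPart (f p) (g p) :=
  (by fun_prop : Continuous fun p => Real.cos (g p * Real.arctan (f p))).mul
    (Continuous.rpow (by fun_prop) (by fun_prop) fun p => Or.inl (by positivity))

theorem continuous_deriv_sinPart {X : Type*} [TopologicalSpace X] {f g : X → ℝ}
    (hf : Continuous f) (hg : Continuous g) :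
    Continuous fun p =>
      g p * (1 / (1 + f p ^ 2)) * (cosPart (f p) (g p) - f p * sinPart (f p) (g p)) :=
  (hg.mul (continuous_one_div_one_add_sq.comp hf)).mul
    ((continuous_cosPart hf hg).sub (hf.mul (continuous_sinPart hf hg)))

theorem continuous_deriv_cosPart {X : Type*} [TopologicalSpace X] {f g : X → ℝ}
    (hf : Continuous f) (hg : Continuous g) :
    Continuous fun p =>
      g p * (1 / (1 + f p ^ 2)) * (-(f p * cosPart (f p) (g p)) - sinPart (f p) (g p)) :=
  (hg.mul (continuous_one_div_one_add_sq.comp hf)).mul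
    ((hf.mul (continuous_cosPart hf hg)).neg.sub (continuous_sinPart hf hg))

variable (Ω) in
/-- The stream `sinPart`. -/
def sinStream : C1Stream C(Ω, ℝ) :=
  .ofHasDerivAt (fun t x => sinPart t x)
    (fun t x => x * (1 / (1 + t ^ 2)) * (cosPart t x - t * sinPart t x))
    (continuous_sinPart continuous_fst (continuous_subtype_val.comp continuous_snd))
    (continuous_deriv_sinPart continuous_fst (continuous_subtype_val.comp continuous_snd))
    fun t x => hasDerivAt_sinPart t x

variable (Ω) in
/-- The stream `cosPart`. -/
def cosStream : C1Stream C(Ω, ℝ) :=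
  .ofHasDerivAt (fun t x => cosPart t x)
    (fun t x => x * (1 / (1 + t ^ 2)) * (-(t * cosPart t x) - sinPart t x))
    (continuous_cosPart continuous_fst (continuous_subtype_val.comp continuous_snd))
    (continuous_deriv_cosPart continuous_fst (continuous_subtype_val.comp continuous_snd))
    fun t x => hasDerivAt_cosPart t x

variable {g c : C(Ω, ℝ)} {last : Node Ω zetaTy noInputs .fnScalar}

/-- The integrators of `zetaNetwork` determine the four streams that are fed back. -/
theorem feedback_unique {inp} {st : (zetaNetwork g c last).State}
    (hst : (zetaNetwork g c last).IsSolution inp st) :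
    st (10 : Fin 31) = lorentzStream Ω ∧ st (14 : Fin 31) = logisticStream Ω ∧
      st (22 : Fin 31) = sinStream Ω ∧ st (23 : Fin 31) = cosStream Ω := by
  have h : ∀ j : Fin 31, (zetaNode g c last j).Outputs inp st (st j) := hst
  let s6 : C1Stream C(Ω, ℝ) := st (6 : Fin 31)
  let s9 : C1Stream C(Ω, ℝ) := st (9 : Fin 31)
  let s10 : C1Stream C(Ω, ℝ) := st (10 : Fin 31)
  let s13 : C1Stream C(Ω, ℝ) := st (13 : Fin 31)
  let s14 : C1Stream C(Ω, ℝ) := st (14 : Fin 31)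
  let s21 : C1Stream C(Ω, ℝ) := st (21 : Fin 31)
  let s22 : C1Stream C(Ω, ℝ) := st (22 : Fin 31)
  let s23 : C1Stream C(Ω, ℝ) := st (23 : Fin 31)
  let s24 : C1Stream C(Ω, ℝ) := st (24 : Fin 31)
  have h0 : (show ℝ from st (0 : Fin 31)) = 0 := h 0
  have h1 : (show ℝ from st (1 : Fin 31)) = 1 / 2 := h 1
  have h2 : (show ℝ from st (2 : Fin 31)) = 1 := h 2
  have h3 : ∀ t, (show C1Stream ℝ from st (3 : Fin 31)) t = -1 := fun t =>
    congrArg (fun u : C1Stream ℝ => u t) (h 3)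
  have h4 : ∀ t, (show C1Stream ℝ from st (4 : Fin 31)) t = Real.pi := fun t =>
    congrArg (fun u : C1Stream ℝ => u t) (h 4)
  have h5 : ∀ t (x : Ω), (show C1Stream C(Ω, ℝ) from st (5 : Fin 31)) t x = x := fun t x =>
    congrArg (fun u : C1Stream C(Ω, ℝ) => u t x) (h 5)
  have h6 : ∀ t x, s6 t x = -t := fun t x => by
    refine (DFunLike.congr_fun (h 6 t) x).trans ?_
    change (show C1Stream ℝ from st (3 : Fin 31)) t * (1 * (t : ℝ)) = -t
    rw [h3]
    ring
  have h9 : ∀ t x, s9 t x = -2 * t * s10 t x ^ 2 := fun t x => by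
    have e7 := DFunLike.congr_fun (h 7 t) x
    have e8 := DFunLike.congr_fun (h 8 t) x
    refine (DFunLike.congr_fun (h 9 t) x).trans
      ((congrArg₂ (· * ·) e7 e8).trans ?_)
    change (s6 t x + s6 t x) * (s10 t x * s10 t x) = _
    rw [h6]
    ring
  have h13 : ∀ t x, s13 t x = Real.pi * (s14 t x * (s14 t x - 1)) := fun t x => by
    have e11 := DFunLike.congr_fun (h 11 t) x
    have e12 := DFunLike.congr_fun (h 12 t) x
    refine (DFunLike.congr_fun (h 13 t) x).trans
      ((congrArg₂ (· * ·) (h4 t) (e12.trans (congrArg₂ (· * ·) rfl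
        (e11.trans (congrArg₂ (· + ·) rfl (h3 t)))))).trans ?_)
    rfl
  have e10 : ∀ t x, s10 t x = 1 / (1 + (t : ℝ) ^ 2) := fun t x => by
    refine eq_one_div_one_add_sq (w := fun t => s10 t x) (by fun_prop) (fun t => ?_) t
    refine (isIntegralFn_lift_time_iff.1 (h 10) t x).trans
      (congrArg₂ (· + ·) h2 (intervalIntegral.integral_congr fun s _ => h9 _ x))
  have e14 : ∀ t x, s14 t x = 1 / (Real.exp (Real.pi * t) + 1) := fun t x => by
    refine eq_one_div_exp_add_one (w := fun t => s14 t x) (by fun_prop) (fun t => ?_) t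
    refine (isIntegralFn_lift_time_iff.1 (h 14) t x).trans
      (congrArg₂ (· + ·) h1 (intervalIntegral.integral_congr fun s _ => h13 _ x))
  have h15 : ∀ t (x : Ω), (show C1Stream C(Ω, ℝ) from st (15 : Fin 31)) t x =
      x * (1 / (1 + (t : ℝ) ^ 2)) := fun t x =>
    (DFunLike.congr_fun (h 15 t) x).trans (congrArg₂ (· * ·) (h5 t x) (e10 t x))
  have h21 : ∀ t (x : Ω), s21 t x = x * (1 / (1 + (t : ℝ) ^ 2)) * (s23 t x - t * s22 t x) :=
    fun t x => by
    have e16 := DFunLike.congr_fun (h 16 t) x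
    have e19 := DFunLike.congr_fun (h 19 t) x
    refine (DFunLike.congr_fun (h 21 t) x).trans
      (congrArg₂ (· * ·) (h15 t x) (e19.trans ((congrArg₂ (· + ·) rfl e16).trans ?_)))
    change s23 t x + s6 t x * s22 t x = _
    rw [h6]
    ring
  have h24 : ∀ t (x : Ω), s24 t x = x * (1 / (1 + (t : ℝ) ^ 2)) * (-(t * s23 t x) - s22 t x) :=
    fun t x => by
    have e17 := DFunLike.congr_fun (h 17 t) x
    have e18 := DFunLike.congr_fun (h 18 t) x
    have e20 := DFunLike.congr_fun (h 20 t) x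
    refine (DFunLike.congr_fun (h 24 t) x).trans
      (congrArg₂ (· * ·) (h15 t x) (e20.trans ((congrArg₂ (· + ·) e17 e18).trans ?_)))
    change s6 t x * s23 t x + (show C1Stream ℝ from st (3 : Fin 31)) t * s22 t x = _
    rw [h6, h3]
    ring
  have e22 : ∀ t (x : Ω), s22 t x = sinPart t x ∧ s23 t x = cosPart t x := fun t x => by
    refine eq_sinPart_and_eq_cosPart (a := fun t => s22 t x) (b := fun t => s23 t x)
      (by fun_prop) (by fun_prop) (fun t => ?_) (fun t => ?_) t
    · exact (isIntegralFn_lift_time_iff.1 (h 22) t x).trans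
        (congrArg₂ (· + ·) h0 (intervalIntegral.integral_congr fun s _ => h21 _ x))
    · exact (isIntegralFn_lift_time_iff.1 (h 23) t x).trans
        (congrArg₂ (· + ·) h2 (intervalIntegral.integral_congr fun s _ => h24 _ x))
  exact ⟨C1Stream.ext_apply fun t => ContinuousMap.ext (e10 t),
    C1Stream.ext_apply fun t => ContinuousMap.ext (e14 t),
    C1Stream.ext_apply fun t => ContinuousMap.ext fun x => (e22 t x).1,
    C1Stream.ext_apply fun t => ContinuousMap.ext fun x => (e22 t x).2⟩

variable [LocallyCompactSpace Ω]

variable (Ω) in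
/-- The stream `ζ₂` of the values of `zetaIntegrand`. -/
def zetaIntegrandStream : C1Stream C(Ω, ℝ) := (sinStream Ω).mul (logisticStream Ω)

theorem zetaIntegrandStream_apply (t : ℝ≥0) (x : Ω) :
    zetaIntegrandStream Ω t x = zetaIntegrand t x :=
  sinPart_mul_eq_zetaIntegrand t x

/-- The stream `g ζ₂`. -/
def weightedIntegrandStream (g : C(Ω, ℝ)) : C1Stream C(Ω, ℝ) :=
  (C1Stream.const g).mul (zetaIntegrandStream Ω)

/-- The stream `c + ∫ g ζ₂`, which is `ζ₁` for suitable `g` and `c`. -/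
def zetaIntegralStream (g c : C(Ω, ℝ)) : C1Stream C(Ω, ℝ) :=
  .primitive c (weightedIntegrandStream g).toMap

variable (Ω) in
/-- The stream `-t`. -/
def negTime : C1Stream C(Ω, ℝ) :=
  (C1Stream.lift Ω (.const (-1))).mul (.lift Ω .time)

variable (Ω) in
/-- The stream `x / (1 + t ^ 2)`. -/
def rateStream : C1Stream C(Ω, ℝ) := (C1Stream.const (coordinate Ω)).mul (lorentzStream Ω)

variable (Ω) in
/-- The factor `b - t a` of the derivative of `a = sinPart`, where `b = cosPart`. -/
def sinFactor : C1Stream C(Ω, ℝ) := (cosStream Ω).add ((negTime Ω).mul (sinStream Ω))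

variable (Ω) in
/-- The factor `-t b - a` of the derivative of `b = cosPart`, where `a = sinPart`. -/
def cosFactor : C1Stream C(Ω, ℝ) :=
  ((negTime Ω).mul (cosStream Ω)).add ((C1Stream.lift Ω (.const (-1))).mul (sinStream Ω))

/-- The solution of the equations of `zetaNetwork g c last`; the output of `last` is `z`. -/
def zetaState (g c z : C(Ω, ℝ)) : ∀ j : Fin 31, Val Ω (zetaTy j)
  | 0 => (0 : ℝ)
  | 1 => (1 / 2 : ℝ)
  | 2 => (1 : ℝ)
  | 3 => C1Stream.const (-1 : ℝ)
  | 4 => C1Stream.const Real.pi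
  | 5 => C1Stream.const (coordinate Ω)
  | 6 => negTime Ω
  | 7 => (negTime Ω).add (negTime Ω)
  | 8 => (lorentzStream Ω).mul (lorentzStream Ω)
  | 9 => ((negTime Ω).add (negTime Ω)).mul ((lorentzStream Ω).mul (lorentzStream Ω))
  | 10 => lorentzStream Ω
  | 11 => (logisticStream Ω).add (.lift Ω (.const (-1)))
  | 12 => (logisticStream Ω).mul ((logisticStream Ω).add (.lift Ω (.const (-1))))
  | 13 => (C1Stream.lift Ω (.const Real.pi)).mul
      ((logisticStream Ω).mul ((logisticStream Ω).add (.lift Ω (.const (-1)))))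
  | 14 => logisticStream Ω
  | 15 => rateStream Ω
  | 16 => (negTime Ω).mul (sinStream Ω)
  | 17 => (negTime Ω).mul (cosStream Ω)
  | 18 => (C1Stream.lift Ω (.const (-1))).mul (sinStream Ω)
  | 19 => sinFactor Ω
  | 20 => cosFactor Ω
  | 21 => (rateStream Ω).mul (sinFactor Ω)
  | 22 => sinStream Ω
  | 23 => cosStream Ω
  | 24 => (rateStream Ω).mul (cosFactor Ω)
  | 25 => zetaIntegrandStream Ω
  | 26 => C1Stream.const g
  | 27 => weightedIntegrandStream g
  | 28 => c
  | 29 => zetaIntegralStream g c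
  | 30 => z
  | ⟨n + 31, h⟩ => absurd h (by omega)

variable {z : C(Ω, ℝ)}

theorem zetaState_isSolution (inp) (hlast : last.Outputs inp (zetaState g c z) z) :
    (zetaNetwork g c last).IsSolution inp (zetaState g c z) := by
  have key : ∀ j : Fin 31,
      (zetaNode g c last j).Outputs inp (zetaState g c z) (zetaState g c z j) := by
    intro j
    match j with
    | 0 => rfl
    | 1 => rfl
    | 2 => rfl
    | 3 => rfl
    | 4 => rfl
    | 5 => rfl
    | 6 => exact fun t => rfl
    | 7 => exact fun t => rfl
    | 8 => exact fun t => rfl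
    | 9 => exact fun t => rfl
    | 10 =>
      refine isIntegralFn_lift_time_iff.2 fun t x => ?_
      refine (eq_add_integral_of_hasDerivAt hasDerivAt_one_div_one_add_sq
        ((by fun_prop : Continuous fun t : ℝ => -2 * t).mul (continuous_one_div_one_add_sq.pow 2))
        (u := fun s => (((negTime Ω).add (negTime Ω)).mul
          ((lorentzStream Ω).mul (lorentzStream Ω))) s x) (fun s => ?_) t).trans ?_
      · change (-1 * (1 * (s : ℝ)) + -1 * (1 * (s : ℝ))) *
          (1 / (1 + (s : ℝ) ^ 2) * (1 / (1 + (s : ℝ) ^ 2))) = _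
        ring
      · exact congrArg₂ (· + ·) (show 1 / (1 + (0 : ℝ) ^ 2) = (1 : ℝ) by norm_num) rfl
    | 11 => exact fun t => rfl
    | 12 => exact fun t => rfl
    | 13 => exact fun t => rfl
    | 14 =>
      refine isIntegralFn_lift_time_iff.2 fun t x => ?_
      refine (eq_add_integral_of_hasDerivAt hasDerivAt_one_div_exp_add_one
        (continuous_const.mul (continuous_one_div_exp_add_one.mul
          (continuous_one_div_exp_add_one.sub continuous_const)))
        (u := fun s => ((C1Stream.lift Ω (.const Real.pi)).mul ((logisticStream Ω).mul
          ((logisticStream Ω).add (.lift Ω (.const (-1)))))) s x) (fun s => rfl) t).trans ?_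
      exact congrArg₂ (· + ·)
        (show 1 / (Real.exp (Real.pi * 0) + 1) = (1 / 2 : ℝ) by norm_num) rfl
    | 15 => exact fun t => rfl
    | 16 => exact fun t => rfl
    | 17 => exact fun t => rfl
    | 18 => exact fun t => rfl
    | 19 => exact fun t => rfl
    | 20 => exact fun t => rfl
    | 21 => exact fun t => rfl
    | 22 =>
      refine isIntegralFn_lift_time_iff.2 fun t x => ?_
      refine (eq_add_integral_of_hasDerivAt (fun s => hasDerivAt_sinPart s x)
        (continuous_deriv_sinPart continuous_id continuous_const)
        (u := fun s => ((rateStream Ω).mul (sinFactor Ω)) s x) (fun s => ?_) t).trans ?_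
      · change x * (1 / (1 + (s : ℝ) ^ 2)) *
          (cosPart s x + -1 * (1 * (s : ℝ)) * sinPart s x) = _
        ring
      · exact congrArg₂ (· + ·) (show sinPart 0 x = (0 : ℝ) by simp [sinPart]) rfl
    | 23 =>
      refine isIntegralFn_lift_time_iff.2 fun t x => ?_
      refine (eq_add_integral_of_hasDerivAt (fun s => hasDerivAt_cosPart s x)
        (continuous_deriv_cosPart continuous_id continuous_const)
        (u := fun s => ((rateStream Ω).mul (cosFactor Ω)) s x) (fun s => ?_) t).trans ?_
      · change x * (1 / (1 + (s : ℝ) ^ 2)) *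
          (-1 * (1 * (s : ℝ)) * cosPart s x + -1 * sinPart s x) = _
        ring
      · exact congrArg₂ (· + ·) (show cosPart 0 x = (1 : ℝ) by simp [cosPart]) rfl
    | 24 => exact fun t => rfl
    | 25 => exact fun t => rfl
    | 26 => rfl
    | 27 => exact fun t => rfl
    | 28 => rfl
    | 29 => exact isIntegralFn_lift_time_iff.2 fun t x => rfl
    | 30 => exact hlast
    | ⟨n + 31, h⟩ => exact absurd h (by omega)
  exact key

/-- Every solution of the equations of `zetaNetwork g c last` agrees with `zetaState` at all modules
but the last: this is known for the four streams that are fed back, and the other modules are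
computed from these one after the other. -/
theorem eq_zetaState_of_isSolution {inp} {st : (zetaNetwork g c last).State}
    (hst : (zetaNetwork g c last).IsSolution inp st) {j : Fin 31} (hj : j ≠ 30) :
    st j = zetaState g c z j := by
  -- the network with a constant in place of its last module has the same modules `j ≠ 30`
  set S : ∀ j : Fin 31, Val Ω (zetaTy j) := zetaState g c z
  have hs : ∀ j : Fin 31, (zetaNode g c (.constFnScalar z) j).Outputs inp S (S j) :=
    zetaState_isSolution inp rfl
  have h : ∀ j : Fin 31, (zetaNode g c last j).Outputs inp st (st j) := hst
  obtain ⟨e10, e14, e22, e23⟩ := feedback_unique hst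
  have mulEq : ∀ {u v u' v' w w' : C1Stream C(Ω, ℝ)}, (∀ t, w t = u t * v t) →
      (∀ t, w' t = u' t * v' t) → u = u' → v = v' → w = w' := by
    rintro u v _ _ w w' hw hw' rfl rfl
    exact C1Stream.ext_apply fun t => (hw t).trans (hw' t).symm
  have addEq : ∀ {u v u' v' w w' : C1Stream C(Ω, ℝ)}, (∀ t, w t = u t + v t) →
      (∀ t, w' t = u' t + v' t) → u = u' → v = v' → w = w' := by
    rintro u v _ _ w w' hw hw' rfl rfl
    exact C1Stream.ext_apply fun t => (hw t).trans (hw' t).symm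
  have e3 : st (3 : Fin 31) = S 3 := h 3
  have e4 : st (4 : Fin 31) = S 4 := h 4
  have e5 : st (5 : Fin 31) = S 5 := h 5
  have l3 := congrArg (C1Stream.lift Ω) e3
  have l4 := congrArg (C1Stream.lift Ω) e4
  have e6 : st (6 : Fin 31) = S 6 := mulEq (h 6) (hs 6) l3 rfl
  have e7 : st (7 : Fin 31) = S 7 := addEq (h 7) (hs 7) e6 e6
  have e8 : st (8 : Fin 31) = S 8 := mulEq (h 8) (hs 8) e10 e10
  have e9 : st (9 : Fin 31) = S 9 := mulEq (h 9) (hs 9) e7 e8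
  have e11 : st (11 : Fin 31) = S 11 := addEq (h 11) (hs 11) e14 l3
  have e12 : st (12 : Fin 31) = S 12 := mulEq (h 12) (hs 12) e14 e11
  have e13 : st (13 : Fin 31) = S 13 := mulEq (h 13) (hs 13) l4 e12
  have e15 : st (15 : Fin 31) = S 15 := mulEq (h 15) (hs 15) e5 e10
  have e16 : st (16 : Fin 31) = S 16 := mulEq (h 16) (hs 16) e6 e22
  have e17 : st (17 : Fin 31) = S 17 := mulEq (h 17) (hs 17) e6 e23
  have e18 : st (18 : Fin 31) = S 18 := mulEq (h 18) (hs 18) l3 e22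
  have e19 : st (19 : Fin 31) = S 19 := addEq (h 19) (hs 19) e23 e16
  have e20 : st (20 : Fin 31) = S 20 := addEq (h 20) (hs 20) e17 e18
  have e21 : st (21 : Fin 31) = S 21 := mulEq (h 21) (hs 21) e15 e19
  have e24 : st (24 : Fin 31) = S 24 := mulEq (h 24) (hs 24) e15 e20
  have e25 : st (25 : Fin 31) = S 25 := mulEq (h 25) (hs 25) e22 e14
  have e26 : st (26 : Fin 31) = S 26 := h 26
  have e27 : st (27 : Fin 31) = S 27 := mulEq (h 27) (hs 27) e26 e25
  have e28 : st (28 : Fin 31) = S 28 := h 28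
  have e29 : st (29 : Fin 31) = S 29 := by
    refine C1Stream.ext_apply fun t => ContinuousMap.ext fun x =>
      (isIntegralFn_lift_time_iff.1 (h 29) t x).trans ?_
    change (show C(Ω, ℝ) from st (28 : Fin 31)) x + ∫ s in (0 : ℝ)..t,
      (show C1Stream C(Ω, ℝ) from st (27 : Fin 31)) s.toNNReal x = _
    rw [e27, e28]
    rfl
  match j, hj with
  | 0, _ => exact h 0
  | 1, _ => exact h 1
  | 2, _ => exact h 2
  | 3, _ => exact e3
  | 4, _ => exact e4
  | 5, _ => exact e5
  | 6, _ => exact e6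
  | 7, _ => exact e7
  | 8, _ => exact e8
  | 9, _ => exact e9
  | 10, _ => exact e10
  | 11, _ => exact e11
  | 12, _ => exact e12
  | 13, _ => exact e13
  | 14, _ => exact e14
  | 15, _ => exact e15
  | 16, _ => exact e16
  | 17, _ => exact e17
  | 18, _ => exact e18
  | 19, _ => exact e19
  | 20, _ => exact e20
  | 21, _ => exact e21
  | 22, _ => exact e22
  | 23, _ => exact e23
  | 24, _ => exact e24
  | 25, _ => exact e25
  | 26, _ => exact e26
  | 27, _ => exact e27
  | 28, _ => exact e28
  | 29, _ => exact e29
  | 30, hj => exact absurd rfl hj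
  | ⟨n + 31, h⟩, _ => exact absurd h (by omega)

/-- `zetaNetwork g c last` is well-posed if the output of its last module is determined by the
outputs of the others. -/
theorem zetaNetwork_generates
    (hlast : ∀ inp (st : (zetaNetwork g c last).State) v,
      (∀ j : Fin 31, j ≠ 30 → st j = zetaState g c z j) → (last.Outputs inp st v ↔ v = z)) :
    (zetaNetwork g c last).Generates univ fun _ => zetaState g c z := by
  have hsol : ∀ inp, (zetaNetwork g c last).IsSolution inp (zetaState g c z) := fun inp =>
    zetaState_isSolution inp ((hlast inp _ _ fun j _ => rfl).2 rfl)
  refine ⟨⟨isOpen_univ, fun inp _ => ⟨_, hsol inp, fun st hst => ?_⟩, _, continuousOn_const,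
    fun inp _ => hsol inp⟩, fun inp _ => hsol inp⟩
  have hne : ∀ j : Fin 31, j ≠ 30 → st j = zetaState g c z j := fun j hj =>
    eq_zetaState_of_isSolution hst hj
  funext j
  by_cases hj : j = (30 : Fin 31)
  · subst hj
    exact (hlast inp st _ hne).1 (hst (30 : Fin 31))
  · exact hne j hj

end Network

/-! ### Linear moduli -/

/-- A real network that multiplies the constant `C` by time. -/
def linearNetwork (C : ℝ) : Network univ where
  numModules := 2
  numInputs := 0
  ty := fun _ => .realStream
  inTy := Fin.elim0
  node
    | 0 => .constReal C
    | 1 => .mulReal (.node 0) .time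

theorem isEffectiveModulus_linear {C : ℝ} (hC : 0 ≤ C) :
    IsEffectiveModulus (C1Stream.linear C) := by
  refine ⟨fun s t hst => mul_le_mul_of_nonneg_left (NNReal.coe_le_coe.2 hst) hC,
    linearNetwork C, rfl, ⟨fun _ => Or.inr rfl, fun i => i.elim0⟩, ?_⟩
  let F : Fin 2 → C1Stream ℝ := ![C1Stream.const C, C1Stream.linear C]
  have hsol : ∀ inp, (linearNetwork C).IsSolution inp F := fun inp (j : Fin 2) =>
    match j with
    | 0 => rfl
    | 1 => fun t => congrArg (C * ·) (one_mul (t : ℝ)).symm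
  refine ⟨fun _ => F, ⟨⟨isOpen_univ, fun inp _ => ⟨F, hsol inp, fun st hst => ?_⟩, _,
    continuousOn_const, fun inp _ => hsol inp⟩, fun inp _ => hsol inp⟩, (1 : Fin 2), fun _ => rfl⟩
  have h0 : st (0 : Fin 2) = C1Stream.const C := hst (0 : Fin 2)
  have h1 : st (1 : Fin 2) = C1Stream.linear C := by
    refine C1Stream.ext_apply fun t => (hst (1 : Fin 2) t).trans ?_
    change (show C1Stream ℝ from st (0 : Fin 2)) t * (1 * (t : ℝ)) = C * (t : ℝ)
    rw [h0, one_mul]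
    rfl
  funext (j : Fin 2)
  match j with
  | 0 => exact h0
  | 1 => exact h1

/-! ### The zeta function as a limit -/

/-- In this limit-free instance of `zetaNetwork` the modules after the one that outputs `ζ₂` play no
role; their constants are set to `coordinate Ω`. -/
theorem isGPACGenerable_zetaIntegrandStream {Ω : Set ℝ} [LocallyCompactSpace Ω] :
    IsGPACGenerable {coordinate Ω} (zetaIntegrandStream Ω) := by
  refine ⟨zetaNetwork (coordinate Ω) (coordinate Ω) (.constFnScalar (coordinate Ω)), rfl, ?_, ?_,
    _, zetaNetwork_generates (z := coordinate Ω) fun inp st v _ => Iff.rfl, (25 : Fin 31),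
    fun _ => rfl⟩
  · intro (j : Fin 31)
    fin_cases j <;> exact not_false
  · intro (j : Fin 31)
    fin_cases j <;> first | exact empty_subset _ | exact subset_rfl

theorem one_lt_of_mem_Ici_two (x : Ici (2 : ℝ)) : 1 < (x : ℝ) := one_lt_two.trans_le x.2

/-- The function `x ↦ -2 ^ x` on `[2, ∞)`. -/
def negTwoPow : C(Ici (2 : ℝ), ℝ) where
  toFun x := -(2 : ℝ) ^ (x : ℝ)
  continuous_toFun :=
    (continuous_const.rpow continuous_subtype_val fun _ => Or.inl two_ne_zero).neg

/-- The function `x ↦ 2 ^ (x - 1) / (x - 1)` on `[2, ∞)`. -/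
def zetaInit : C(Ici (2 : ℝ), ℝ) where
  toFun x := (2 : ℝ) ^ ((x : ℝ) - 1) / ((x : ℝ) - 1)
  continuous_toFun :=
    (continuous_const.rpow (continuous_subtype_val.sub continuous_const) fun _ =>
      Or.inl two_ne_zero).div (by fun_prop) fun x => (sub_pos.2 (one_lt_of_mem_Ici_two x)).ne'

/-- The Riemann zeta function on `[2, ∞)`. -/
def zetaFn : C(Ici (2 : ℝ), ℝ) where
  toFun x := (riemannZeta ((x : ℝ) : ℂ)).re
  continuous_toFun := by
    refine Complex.continuous_re.comp (continuous_iff_continuousAt.2 fun x => ?_)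
    have hx : ((x : ℝ) : ℂ) ≠ 1 := fun h =>
      (one_lt_of_mem_Ici_two x).ne' (Complex.ofReal_eq_one.1 h)
    exact ContinuousAt.comp (f := fun x : Ici (2 : ℝ) => ((x : ℝ) : ℂ))
      (differentiableAt_riemannZeta hx).continuousAt (by fun_prop)

instance : LocallyCompactSpace (Ici (2 : ℝ)) :=
  isClosed_Ici.isClosedEmbedding_subtypeVal.locallyCompactSpace

theorem zetaFn_eq (x : Ici (2 : ℝ)) :
    IntegrableOn (fun s : ℝ => zetaIntegrand s x) (Ioi 0) ∧
      zetaFn x = (2 : ℝ) ^ ((x : ℝ) - 1) / ((x : ℝ) - 1) -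
        (2 : ℝ) ^ (x : ℝ) * ∫ s in Ioi (0 : ℝ), zetaIntegrand s x := by
  obtain ⟨hi, hz⟩ := zeta_integral_formula (one_lt_of_mem_Ici_two x)
  exact ⟨hi, (congrArg Complex.re hz).trans (Complex.ofReal_re _)⟩

theorem ofReal_zetaFn (x : Ici (2 : ℝ)) : ((zetaFn x : ℝ) : ℂ) = riemannZeta ((x : ℝ) : ℂ) := by
  rw [(zeta_integral_formula (one_lt_of_mem_Ici_two x)).2, (zetaFn_eq x).2]

theorem zetaIntegralStream_apply (t : ℝ≥0) (x : Ici (2 : ℝ)) :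
    zetaIntegralStream negTwoPow zetaInit t x =
      (2 : ℝ) ^ ((x : ℝ) - 1) / ((x : ℝ) - 1) -
        (2 : ℝ) ^ (x : ℝ) * ∫ s in (0 : ℝ)..(t : ℝ), zetaIntegrand s x := by
  have hint : ∫ s in (0 : ℝ)..t, weightedIntegrandStream negTwoPow s.toNNReal x =
      ∫ s in (0 : ℝ)..t, -(2 : ℝ) ^ (x : ℝ) * zetaIntegrand s x := by
    refine intervalIntegral.integral_congr fun s hs => ?_
    rw [uIcc_of_le t.coe_nonneg] at hs
    refine (congrArg (-(2 : ℝ) ^ (x : ℝ) * ·) (zetaIntegrandStream_apply _ x)).trans ?_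
    simp only [Real.coe_toNNReal s hs.1]
  refine (C1Stream.primitive_apply _ _ t x).trans ?_
  rw [hint, intervalIntegral.integral_const_mul, neg_mul, ← sub_eq_add_neg]
  rfl

theorem tendsto_zetaIntegralStream :
    Tendsto (zetaIntegralStream negTwoPow zetaInit) atTop (𝓝 zetaFn) :=
  tendsto_of_zetaIntegrand zetaIntegralStream_apply zetaFn_eq

theorem isConvergentCauchy_zetaIntegralStream {C : ℝ} (hC : 1 ≤ C) :
    IsConvergentCauchy (C1Stream.linear C) (zetaIntegralStream negTwoPow zetaInit) :=
  isConvergentCauchy_of_zetaIntegrand zetaIntegralStream_apply fun τ =>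
    le_mul_of_one_le_left τ.coe_nonneg hC

/-- The network that computes the zeta function as a limit. -/
abbrev zetaLimitNetwork : Network (Ici (2 : ℝ)) :=
  zetaNetwork negTwoPow zetaInit (.limit (.node 29))

theorem zetaLimitNetwork_generates :
    zetaLimitNetwork.Generates univ fun _ => zetaState negTwoPow zetaInit zetaFn := by
  refine zetaNetwork_generates fun inp st v hst => ?_
  have h29 : st (29 : Fin 31) = zetaIntegralStream negTwoPow zetaInit := hst 29 (by decide)
  have hlim : IsIdLimit (zetaIntegralStream negTwoPow zetaInit) v ↔ v = zetaFn :=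
    ⟨fun h => tendsto_nhds_unique (X := C(Ici (2 : ℝ), ℝ)) h.2
      tendsto_zetaIntegralStream,
      fun h => h ▸ ⟨isConvergentCauchy_zetaIntegralStream le_rfl, tendsto_zetaIntegralStream⟩⟩
  rw [← hlim, ← h29]
  exact Iff.rfl

theorem zetaLimitNetwork_constantsIn :
    zetaLimitNetwork.ConstantsIn {coordinate _, negTwoPow, zetaInit} := by
  intro (j : Fin 31)
  fin_cases j <;> first
    | exact empty_subset _
    | exact singleton_subset_iff.2 (by simp)

theorem zetaLimitNetwork_isProperOutput : zetaLimitNetwork.IsProperOutput (30 : Fin 31) := by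
  intro (i : Fin 31)
  change (30 : Fin 31) ∉ (zetaNode negTwoPow zetaInit (.limit (.node 29)) i).reads
  fin_cases i <;> simp [zetaNode, Node.reads, Source.reads]

end LGPAC

end

theorem mainTheorem2 :
    ∃ (ident negTwoPow init ζ : C(Set.Ici (2 : ℝ), ℝ))
      (ζ₁ ζ₂ negTwoPowζ₂ : LGPAC.C1Stream C(Set.Ici (2 : ℝ), ℝ)),
      -- the constants and functions involved
      (∀ x : Set.Ici (2 : ℝ), ident x = (x : ℝ)) ∧
      (∀ x : Set.Ici (2 : ℝ), negTwoPow x = -((2 : ℝ) ^ (x : ℝ))) ∧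
      (∀ x : Set.Ici (2 : ℝ), init x = (2 : ℝ) ^ ((x : ℝ) - 1) / ((x : ℝ) - 1)) ∧
      (∀ x : Set.Ici (2 : ℝ), ((ζ x : ℝ) : ℂ) = riemannZeta ((x : ℝ) : ℂ)) ∧
      (∀ (t : NNReal) (x : Set.Ici (2 : ℝ)), ζ₂ t x = LGPAC.zetaIntegrand t x) ∧
      (∀ (t : NNReal) (x : Set.Ici (2 : ℝ)), negTwoPowζ₂ t x = negTwoPow x * ζ₂ t x) ∧
      (∀ (t : NNReal) (x : Set.Ici (2 : ℝ)),
        ζ₁ t x = (2 : ℝ) ^ ((x : ℝ) - 1) / ((x : ℝ) - 1) -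
          (2 : ℝ) ^ (x : ℝ) * ∫ s in (0 : ℝ)..(t : ℝ), LGPAC.zetaIntegrand s x) ∧
      -- the integral representation of zeta, and zeta as a limit in the function space
      (∀ x : Set.Ici (2 : ℝ),
        MeasureTheory.IntegrableOn (fun s : ℝ => LGPAC.zetaIntegrand s x) (Set.Ioi 0) ∧
        ζ x = (2 : ℝ) ^ ((x : ℝ) - 1) / ((x : ℝ) - 1) -
          (2 : ℝ) ^ (x : ℝ) * ∫ s in Set.Ioi (0 : ℝ), LGPAC.zetaIntegrand s x) ∧
      Filter.Tendsto (fun t : NNReal => ζ₁ t) Filter.atTop (nhds ζ) ∧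
      -- the limit is effective, with modulus `C τ` for every `C ≥ 1`, so with the identity
      (∀ C : ℝ, 1 ≤ C → LGPAC.IsEffectiveModulus (LGPAC.C1Stream.linear C) ∧
        LGPAC.IsConvergentCauchy (LGPAC.C1Stream.linear C) ζ₁) ∧
      -- the integrand is generated without limit modules
      LGPAC.IsGPACGenerable {ident} ζ₂ ∧
      -- an L-GPAC using only the stated constants generates zeta, as the limit of `ζ₁`
      ∃ N : LGPAC.Network (Set.Ici (2 : ℝ)),
        N.numInputs = 0 ∧ N.ConstantsIn {ident, negTwoPow, init} ∧
        ∃ F : N.Inputs → N.State, N.Generates Set.univ F ∧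
          ∃ j₂ j₁ j : Fin N.numModules, N.IsProperOutput j ∧ ∀ inp : N.Inputs,
            LGPAC.Network.Carries (F inp) j₂ (σ := .fnStream) ζ₂ ∧
            LGPAC.Network.Carries (F inp) j₁ (σ := .fnStream) ζ₁ ∧
            LGPAC.Network.IsIntegratorOf inp (F inp) j₁ init negTwoPowζ₂
              (LGPAC.C1Stream.lift (Set.Ici 2) LGPAC.C1Stream.time) ∧
            LGPAC.Network.Carries (F inp) j (σ := .fnScalar) ζ ∧
            LGPAC.Network.IsLimitOf inp (F inp) j ζ₁ := by

  exact ⟨LGPAC.coordinate _, LGPAC.negTwoPow, LGPAC.zetaInit, LGPAC.zetaFn,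
    LGPAC.zetaIntegralStream LGPAC.negTwoPow LGPAC.zetaInit, LGPAC.zetaIntegrandStream _,
    LGPAC.weightedIntegrandStream LGPAC.negTwoPow, fun _ => rfl, fun _ => rfl, fun _ => rfl,
    LGPAC.ofReal_zetaFn, LGPAC.zetaIntegrandStream_apply, fun _ _ => rfl,
    LGPAC.zetaIntegralStream_apply, LGPAC.zetaFn_eq, LGPAC.tendsto_zetaIntegralStream,
    fun _ hC => ⟨LGPAC.isEffectiveModulus_linear (zero_le_one.trans hC),
      LGPAC.isConvergentCauchy_zetaIntegralStream hC⟩,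
    LGPAC.isGPACGenerable_zetaIntegrandStream,
    LGPAC.zetaLimitNetwork, rfl, LGPAC.zetaLimitNetwork_constantsIn,
    _, LGPAC.zetaLimitNetwork_generates, (25 : Fin 31), (29 : Fin 31), (30 : Fin 31),
    LGPAC.zetaLimitNetwork_isProperOutput, fun _ => ⟨rfl, rfl,
      ⟨.node (28 : Fin 31), .node (27 : Fin 31), .liftStream .time, rfl, rfl, rfl, rfl⟩, rfl,
      ⟨.node (29 : Fin 31), rfl, rfl⟩⟩⟩
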